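/- Let $n\ge 1$, let $f=(f_1,\dots,f_n):\mathbb{R}^n\to\mathbb{R}^n$ be a $C^3$-diffeomorphism (a bijection of $\mathbb{R}^n$ onto itself such that $f$ and $f^{-1}$ are of class $C^3$), and write $X=f(x)$, $x=f^{-1}(X)$. Fix $\alpha\in\{1,\dots,n\}$. In $L^2(\mathbb{R}^n)$ (complex-valued functions, Lebesgue measure) let $X_\alpha$ be the operator of multiplication by $f_\alpha(x)$ with domain $D(X_\alpha)=\{u : u,\ f_\alpha u\in L^2(\mathbb{R}^n)\}$, and let $\dot P_\alpha$ be the operator with domain $C_0^3(\mathbb{R}^n)$ (the compactly supported $C^3$ functions) given by DeWitt's symmetrized momentum $$\dot P_\alpha u=\frac12\sum_{\beta=1}^n\left(\frac{\partial x_\beta}{\partial X_\alpha}\,p_\beta u+p_\beta\Big(\frac{\partial x_\beta}{\partial X_\alpha}\,u\Big)\right),\qquad p_\beta=-i\frac{\partial}{\partial x_\beta},$$ where $\partial x_\beta/\partial X_\alpha$ is evaluated at $X=f(x)$. For an operator $A$ let $\sigma(A)$ be its spectrum and let $\sigma_c(A)$ be its continuous spectrum, that is, the set of $z\in\sigma(A)$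 such that $A-z$ is injective and has dense range. Then: (a) $X_\alpha$ is selfadjoint on $D(X_\alpha)$. (b) $\sigma(X_\alpha)=\sigma_c(X_\alpha)=\mathbb{R}$. (c) $\dot P_\alpha$ is essentially selfadjoint, i.e. it is densely defined and symmetric, and its closure $\overline{\dot P_\alpha}$ is selfadjoint. (d) $\sigma(\overline{\dot P_\alpha})=\sigma_c(\overline{\dot P_\alpha})=\mathbb{R}$. -/

import Mathlib

open MeasureTheory Complex
open scoped Manifold ContDiff

noncomputable section

namespace PointTransformation

section UnboundedOperators

variable {H : Type*} [NormedAddCommGroup H] [InnerProductSpace ℂ H]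

/-- The resolvent set of an unbounded operator `T`: those `z` for which `T - z`, as a map from the
domain of `T` to `H`, is a bijection with bounded inverse `R`. -/
def resolventSet (T : H →ₗ.[ℂ] H) : Set ℂ :=
  {z | ∃ R : H →L[ℂ] H,
    (∀ y : H, ∃ h : R y ∈ T.domain, T ⟨R y, h⟩ - z • R y = y) ∧
    (∀ x : T.domain, R (T x - z • (x : H)) = x)}

/-- The spectrum of an unbounded operator. -/
def spectrum (T : H →ₗ.[ℂ] H) : Set ℂ := (resolventSet T)ᶜ

/-- The continuous spectrum of an unbounded operator: those `z` in the spectrum for which `T - z` is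
injective (so `z` is not an eigenvalue) and has dense range. -/
def continuousSpectrum (T : H →ₗ.[ℂ] H) : Set ℂ :=
  {z | z ∈ spectrum T ∧
    Function.Injective (fun x : T.domain => T x - z • (x : H)) ∧
    DenseRange (fun x : T.domain => T x - z • (x : H))}

/-- An operator is essentially selfadjoint if it is densely defined and symmetric, and its closure
is selfadjoint. -/
def IsEssentiallySelfAdjoint [CompleteSpace H] (T : H →ₗ.[ℂ] H) : Prop :=
  Dense (T.domain : Set H) ∧ T.IsFormalAdjoint T ∧ IsSelfAdjoint T.closure

end UnboundedOperators

/-- Configuration space `ℝⁿ` with its Euclidean structure and Lebesgue measure. -/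
abbrev Space (n : ℕ) : Type := EuclideanSpace ℝ (Fin n)

/-- The Hilbert space `L²(ℝⁿ)` of complex-valued functions. -/
abbrev L2 (n : ℕ) : Type := Lp ℂ 2 (volume : Measure (Space n))

/-- A `C³`-diffeomorphism of `ℝⁿ` onto itself: a bijection which is `C³` together with its inverse.
-/
abbrev C3Diffeo (n : ℕ) : Type := Space n ≃ₘ^3⟮𝓘(ℝ, Space n), 𝓘(ℝ, Space n)⟯ Space n

variable {n : ℕ}

/-- The maximal domain `{u ∈ L² : g u ∈ L²}` of multiplication by the real function `g`. -/
def mulDomain (g : Space n → ℝ) : Submodule ℂ (L2 n) where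
  carrier := {u | MemLp (fun x => (g x : ℂ) * u x) 2 volume}
  zero_mem' := by
    have h : (fun x => (g x : ℂ) * (0 : L2 n) x) =ᵐ[volume] fun _ => (0 : ℂ) := by
      filter_upwards [Lp.coeFn_zero ℂ 2 (volume : Measure (Space n))] with x hx
      rw [hx]
      exact mul_zero _
    exact (memLp_congr_ae h).2 MemLp.zero'
  add_mem' := by
    intro u v hu hv
    refine (memLp_congr_ae ?_).2 (MemLp.add hu hv)
    filter_upwards [Lp.coeFn_add u v] with x hx
    rw [hx]
    exact mul_add _ _ _
  smul_mem' := by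
    intro c u hu
    refine (memLp_congr_ae ?_).2 (MemLp.const_smul hu c)
    filter_upwards [Lp.coeFn_smul c u] with x hx
    rw [hx]
    exact mul_left_comm _ _ _

lemma memLp_of_mem_mulDomain {g : Space n → ℝ} {u : L2 n} (hu : u ∈ mulDomain g) :
    MemLp (fun x => (g x : ℂ) * u x) 2 volume := hu

/-- Multiplication by the real function `g` in `L²(ℝⁿ)`, with its maximal domain. -/
def mulOp (g : Space n → ℝ) : L2 n →ₗ.[ℂ] L2 n where
  domain := mulDomain g
  toFun :=
    { toFun := fun u => (memLp_of_mem_mulDomain u.2).toLp (fun x => (g x : ℂ) * (u : L2 n) x)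
      map_add' := by
        rintro ⟨u, hu⟩ ⟨v, hv⟩
        refine Lp.ext ?_
        filter_upwards [(memLp_of_mem_mulDomain hu).coeFn_toLp,
          (memLp_of_mem_mulDomain hv).coeFn_toLp,
          (memLp_of_mem_mulDomain ((mulDomain g).add_mem hu hv)).coeFn_toLp,
          Lp.coeFn_add ((memLp_of_mem_mulDomain hu).toLp _) ((memLp_of_mem_mulDomain hv).toLp _),
          Lp.coeFn_add u v] with x h1 h2 h3 h4 h5
        refine h3.trans (Eq.trans ?_ h4.symm)
        rw [h5, Pi.add_apply, Pi.add_apply, h1, h2, mul_add]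
      map_smul' := by
        rintro c ⟨u, hu⟩
        refine Lp.ext ?_
        filter_upwards [(memLp_of_mem_mulDomain hu).coeFn_toLp,
          (memLp_of_mem_mulDomain ((mulDomain g).smul_mem c hu)).coeFn_toLp,
          Lp.coeFn_smul c ((memLp_of_mem_mulDomain hu).toLp _),
          Lp.coeFn_smul c u] with x h1 h2 h3 h4
        refine h2.trans (Eq.trans ?_ h3.symm)
        rw [h4, Pi.smul_apply, Pi.smul_apply, h1, smul_eq_mul, smul_eq_mul, mul_left_comm] }

/-- The operator `X_α`: multiplication by the component `f_α(x)`. -/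
def opX (f : C3Diffeo n) (α : Fin n) : L2 n →ₗ.[ℂ] L2 n := mulOp fun x => f x α

/-- The partial derivative `∂g/∂x_β`. -/
def partialDeriv {F : Type*} [NormedAddCommGroup F] [NormedSpace ℝ F] (β : Fin n)
    (g : Space n → F) (x : Space n) : F :=
  fderiv ℝ g x (EuclideanSpace.single β 1)

/-- The momentum `p_β = -i ∂/∂x_β` acting on functions. -/
def momentum (β : Fin n) (u : Space n → ℂ) (x : Space n) : ℂ := -I * partialDeriv β u x

/-- `∂x_β/∂X_α`, where `x = f⁻¹(X)`, as a function of `x`, i.e. evaluated at `X = f(x)`. -/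
def invJacobian (f : C3Diffeo n) (α β : Fin n) (x : Space n) : ℝ :=
  partialDeriv α (fun X => f.symm X β) (f x)

/-- The symmetrized momentum
`P_α u = ½ ∑_β ((∂x_β/∂X_α) p_β u + p_β ((∂x_β/∂X_α) u))` acting on functions. -/
def symmMomentum (f : C3Diffeo n) (α : Fin n) (u : Space n → ℂ) (x : Space n) : ℂ :=
  (1 / 2) * ∑ β : Fin n,
    ((invJacobian f α β x : ℂ) * momentum β u x
      + momentum β (fun y => (invJacobian f α β y : ℂ) * u y) x)

/-- `C₀³(ℝⁿ)`: the `C³` complex-valued functions on `ℝⁿ` with compact support. -/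
def C03 (n : ℕ) : Submodule ℂ (Space n → ℂ) where
  carrier := {u | ContDiff ℝ 3 u ∧ HasCompactSupport u}
  zero_mem' := ⟨contDiff_const, HasCompactSupport.zero⟩
  add_mem' hu hv := ⟨hu.1.add hv.1, hu.2.add hv.2⟩
  smul_mem' c _ hu := ⟨hu.1.const_smul c, hu.2.smul_left (f := fun _ => c)⟩

lemma memLp_of_mem_C03 (u : C03 n) : MemLp (u : Space n → ℂ) 2 volume :=
  u.2.1.continuous.memLp_of_hasCompactSupport u.2.2

/-- The inclusion of `C₀³(ℝⁿ)` in `L²(ℝⁿ)`. -/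
def C03.toL2 (n : ℕ) : C03 n →ₗ[ℂ] L2 n where
  toFun u := (memLp_of_mem_C03 u).toLp u
  map_add' _ _ := rfl
  map_smul' _ _ := rfl

lemma C03.toL2_injective : Function.Injective (C03.toL2 n) := by
  intro u v h
  have h' : (u : Space n → ℂ) =ᵐ[volume] v :=
    (MemLp.toLp_eq_toLp_iff (memLp_of_mem_C03 u) (memLp_of_mem_C03 v)).1 h
  exact Subtype.ext ((Continuous.ae_eq_iff_eq volume u.2.1.continuous v.2.1.continuous).1 h')

lemma contDiff_invJacobian (f : C3Diffeo n) (α β : Fin n) : ContDiff ℝ 2 (invJacobian f α β) := by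
  have h1 : ContDiff ℝ 3 f := f.contMDiff.contDiff
  have h2 : ContDiff ℝ 3 f.symm := f.symm.contMDiff.contDiff
  have h3 : ContDiff ℝ 3 (fun X => f.symm X β) :=
    (EuclideanSpace.proj (𝕜 := ℝ) β).contDiff.comp h2
  have h4 : ContDiff ℝ 2 (fun X => fderiv ℝ (fun X => f.symm X β) X (EuclideanSpace.single α 1)) :=
    (h3.fderiv_right (by norm_num)).clm_apply contDiff_const
  exact h4.comp (h1.of_le (by norm_num))

lemma contDiff_invJacobian_mul (f : C3Diffeo n) (α β : Fin n) (u : C03 n) :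
    ContDiff ℝ 2 (fun y => (invJacobian f α β y : ℂ) * (u : Space n → ℂ) y) :=
  (ofRealCLM.contDiff.comp (contDiff_invJacobian f α β)).mul (u.2.1.of_le (by norm_num))

lemma continuous_momentum {β : Fin n} {u : Space n → ℂ} (hu : ContDiff ℝ 1 u) :
    Continuous (momentum β u) :=
  continuous_const.mul ((hu.continuous_fderiv (by norm_num)).clm_apply continuous_const)

lemma hasCompactSupport_momentum {β : Fin n} {u : Space n → ℂ} (hu : HasCompactSupport u) :
    HasCompactSupport (momentum β u) :=
  (hu.fderiv_apply ℝ (EuclideanSpace.single β 1)).mul_left (f := fun _ => -I)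

lemma memLp_symmMomentum (f : C3Diffeo n) (α : Fin n) (u : C03 n) :
    MemLp (symmMomentum f α u) 2 volume := by
  have hterm : ∀ β : Fin n, MemLp (fun x => (invJacobian f α β x : ℂ) * momentum β u x
      + momentum β (fun y => (invJacobian f α β y : ℂ) * (u : Space n → ℂ) y) x) 2 volume := by
    intro β
    refine MemLp.add ?_ ?_
    · refine Continuous.memLp_of_hasCompactSupport ?_ ?_
      · exact (continuous_ofReal.comp (contDiff_invJacobian f α β).continuous).mul
          (continuous_momentum (u.2.1.of_le (by norm_num)))
      · exact (hasCompactSupport_momentum u.2.2).mul_left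
    · refine Continuous.memLp_of_hasCompactSupport ?_ ?_
      · exact continuous_momentum ((contDiff_invJacobian_mul f α β u).of_le (by norm_num))
      · exact hasCompactSupport_momentum (u.2.2.mul_left)
  exact (memLp_finsetSum Finset.univ fun β _ => hterm β).const_mul _

lemma momentum_add {β : Fin n} {u v : Space n → ℂ} (hu : ContDiff ℝ 1 u) (hv : ContDiff ℝ 1 v) :
    momentum β (u + v) = momentum β u + momentum β v := by
  funext x
  simp only [momentum, partialDeriv, Pi.add_apply]
  rw [fderiv_add (hu.differentiable (by norm_num) x) (hv.differentiable (by norm_num) x)]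
  simp [mul_add]

lemma momentum_smul {β : Fin n} {u : Space n → ℂ} (c : ℂ) (hu : ContDiff ℝ 1 u) :
    momentum β (c • u) = c • momentum β u := by
  funext x
  simp only [momentum, partialDeriv, Pi.smul_apply]
  rw [fderiv_const_smul (hu.differentiable (by norm_num) x)]
  simp only [FunLike.coe_smul, Pi.smul_apply, smul_eq_mul]
  ring

/-- The symmetrized momentum as a linear map from `C₀³(ℝⁿ)` to `L²(ℝⁿ)`. -/
def symmMomentumL2 (f : C3Diffeo n) (α : Fin n) : C03 n →ₗ[ℂ] L2 n where
  toFun u := (memLp_symmMomentum f α u).toLp (symmMomentum f α u)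
  map_add' u v := by
    rw [← MemLp.toLp_add]
    refine MemLp.toLp_congr _ _ (Filter.Eventually.of_forall fun x => ?_)
    simp only [symmMomentum, Pi.add_apply, Submodule.coe_add]
    rw [← mul_add, ← Finset.sum_add_distrib]
    congr 1
    refine Finset.sum_congr rfl fun β _ => ?_
    have h1 := momentum_add (β := β) (u.2.1.of_le (by norm_num) : ContDiff ℝ 1 _)
      (v.2.1.of_le (by norm_num) : ContDiff ℝ 1 _)
    have h2 := momentum_add (β := β)
      ((contDiff_invJacobian_mul f α β u).of_le (by norm_num) : ContDiff ℝ 1 _)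
      ((contDiff_invJacobian_mul f α β v).of_le (by norm_num) : ContDiff ℝ 1 _)
    have h3 : (fun y => (invJacobian f α β y : ℂ) *
          ((u : Space n → ℂ) y + (v : Space n → ℂ) y))
        = (fun y => (invJacobian f α β y : ℂ) * (u : Space n → ℂ) y)
          + fun y => (invJacobian f α β y : ℂ) * (v : Space n → ℂ) y := by
      funext y
      simp [mul_add]
    rw [h3, h2, h1]
    simp only [Pi.add_apply]
    ring
  map_smul' c u := by
    refine Eq.trans (MemLp.toLp_congr _ ((memLp_symmMomentum f α u).const_smul c)
      (Filter.Eventually.of_forall fun x => ?_)) (MemLp.toLp_const_smul c (memLp_symmMomentum f α u))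
    simp only [symmMomentum, Pi.smul_apply, Submodule.coe_smul, smul_eq_mul]
    rw [mul_left_comm c, Finset.mul_sum Finset.univ _ c]
    refine congrArg (fun z : ℂ => 1 / 2 * z) ?_
    refine Finset.sum_congr rfl fun β _ => ?_
    have h1 := momentum_smul (β := β) c (u.2.1.of_le (by norm_num) : ContDiff ℝ 1 _)
    have h2 := momentum_smul (β := β) c
      ((contDiff_invJacobian_mul f α β u).of_le (by norm_num) : ContDiff ℝ 1 _)
    have h3 : (fun y => (invJacobian f α β y : ℂ) * (c * (u : Space n → ℂ) y))
        = c • fun y => (invJacobian f α β y : ℂ) * (u : Space n → ℂ) y := by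
      funext y
      simp only [Pi.smul_apply, smul_eq_mul]
      ring
    rw [h3, h2, h1]
    simp only [Pi.smul_apply, smul_eq_mul]
    ring

/-- The operator `Ṗ_α` in `L²(ℝⁿ)`: the symmetrized momentum with domain (the image in `L²` of)
`C₀³(ℝⁿ)`. -/
def opPDot (f : C3Diffeo n) (α : Fin n) : L2 n →ₗ.[ℂ] L2 n where
  domain := LinearMap.range (C03.toL2 n)
  toFun := symmMomentumL2 f α ∘ₗ
    (LinearEquiv.ofInjective (C03.toL2 n) C03.toL2_injective).symm.toLinearMap

end PointTransformation

end

/-!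
Both operators are shown to be unitarily equivalent to multiplication by a continuous real function
`g` on `ℝⁿ` which is onto `ℝ` and has null level sets. Such a multiplication operator is
selfadjoint, since it is symmetric and division by `g - z` preserves `L²` for nonreal `z`. Its
spectrum is the real line, because indicators of small sets near a level set are approximate
eigenvectors, and it is continuous, because null level sets exclude eigenvectors, and the range of `T - r` for a
selfadjoint `T` is dense when `r` is not an eigenvalue (`IsDiagonalizedBy.isSelfAdjoint`,
`IsDiagonalizedBy.spectrum_eq`).

For `X_α` the function is `f_α` itself; its level sets are null as preimages of hyperplanes under a
diffeomorphism.

For the symmetrized momentum the unitary map is the passage to the coordinates `X = f(x)`, that is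
the inverse of `v ↦ |det Df|^{1/2} (v ∘ f)`, followed by the Fourier transform, and `g = 2π ξ_α`.
The Piola identity `div(|det Df| ∂/∂X_α) = 0` (`fderiv_jacobian_coordField`) shows that the
symmetrized momentum becomes `-i ∂/∂X_α` in these coordinates (`firstOrderOp_pullback`). It remains
to see that the closure of its graph is the whole graph of multiplication by `2π ξ_α`, carried back
to the original space. One inclusion holds since the latter graph is closed
(`graph_opPDot_le_diagonalGraph`). For the other one (`diagonalGraph_le_closure`), Schwartz
functions form a core of the multiplication operator (`exists_schwartz_approx_mulOp`), they are
approximated by compactly supported functions by cutting off (`exists_smooth_approx_schwartz`), and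
the pullbacks of these, which are not of class `C³` in general, are approximated in graph norm by
mollification (`exists_smooth_approx_firstOrderOp`).
-/

noncomputable section

namespace PointTransformation

/-! ### Selfadjointness and continuous spectrum -/

section GraphCriteria

variable {H : Type*} [NormedAddCommGroup H] [InnerProductSpace ℂ H]

/-- A vector orthogonal to the domain is `(T - i) w`, and then `w` is orthogonal to the range of
`T + i`, which is everything. -/
lemma dense_domain_of_surjective_sub [CompleteSpace H] {T : H →ₗ.[ℂ] H}
    (hsymm : T.IsFormalAdjoint T)
    (hsurj : ∀ z : ℂ, z.im ≠ 0 → ∀ y, ∃ x : T.domain, T x - z • (x : H) = y) :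
    Dense (T.domain : Set H) := by
  rw [Submodule.dense_iff_topologicalClosure_eq_top, Submodule.topologicalClosure_eq_top_iff,
    Submodule.eq_bot_iff]
  intro v hv
  rw [Submodule.mem_orthogonal] at hv
  obtain ⟨w, rfl⟩ := hsurj I (by simp) v
  obtain ⟨x, hx⟩ := hsurj (-I) (by simp) w
  have h1 : inner ℂ (w : H) (w : H) = 0 := by
    have h2 := hv x x.2
    rw [inner_sub_right, ← hsymm x w, inner_smul_right] at h2
    rw [← hx, inner_sub_left, inner_smul_left, hx]
    simpa using h2
  have h3 : w = 0 := Subtype.ext (inner_self_eq_zero.1 h1)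
  subst h3
  simp

/-- A symmetric operator `T` for which `T - z` is onto for every nonreal `z` is selfadjoint. -/
lemma isSelfAdjoint_of_surjective_sub [CompleteSpace H] {T : H →ₗ.[ℂ] H}
    (hsymm : T.IsFormalAdjoint T)
    (hsurj : ∀ z : ℂ, z.im ≠ 0 → ∀ y, ∃ x : T.domain, T x - z • (x : H) = y) :
    IsSelfAdjoint T := by
  have hd := dense_domain_of_surjective_sub hsymm hsurj
  rw [LinearPMap.isSelfAdjoint_def]
  refine le_antisymm ?_ (hsymm.le_adjoint hd)
  have hadj := LinearPMap.adjoint_isFormalAdjoint hd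
  have key : ∀ y : T.adjoint.domain, ∃ x : T.domain, (x : H) = y ∧ T x = T.adjoint y := by
    intro y
    obtain ⟨x, hx⟩ := hsurj I (by simp) (T.adjoint y - I • (y : H))
    obtain ⟨q, hq⟩ := hsurj (-I) (by simp) ((y : H) - x)
    have h1 : T x - T.adjoint y = I • ((x : H) - y) := by
      rw [sub_eq_sub_iff_add_eq_add] at hx
      rw [smul_sub, sub_eq_sub_iff_add_eq_add, hx, add_comm]
    have h2 : inner ℂ ((y : H) - x) ((y : H) - x) = 0 := by
      nth_rewrite 2 [← hq]
      have h3 : inner ℂ ((y : H) - x) (T q) = inner ℂ (T.adjoint y - T x) (q : H) := by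
        rw [inner_sub_left, inner_sub_left, hadj y q, hsymm x q]
      have h4 : T.adjoint y - T x = I • ((y : H) - x) := by
        rw [← neg_sub, h1, ← smul_neg, neg_sub]
      rw [inner_sub_right, h3, h4, inner_smul_left, inner_smul_right]
      simp
    have h5 : (y : H) = x := sub_eq_zero.1 (inner_self_eq_zero.1 h2)
    refine ⟨x, h5.symm, ?_⟩
    rw [h5, sub_self, smul_zero] at h1
    exact sub_eq_zero.1 h1
  refine ⟨fun y hy => ?_, fun y x hxy => ?_⟩
  · obtain ⟨x, hx, -⟩ := key ⟨y, hy⟩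
    have h := x.2
    rwa [hx] at h
  · obtain ⟨x', hx', h⟩ := key y
    rw [← h]
    congr 1
    exact Subtype.ext (hx'.trans hxy)

/-- The basic lower bound for a symmetric operator off the real axis. -/
lemma abs_im_mul_norm_le {T : H →ₗ.[ℂ] H} (hsymm : T.IsFormalAdjoint T) (z : ℂ) (x : T.domain) :
    |z.im| * ‖(x : H)‖ ≤ ‖T x - z • (x : H)‖ := by
  rcases eq_or_ne (x : H) 0 with h0 | h0
  · rw [h0, norm_zero, mul_zero]
    exact norm_nonneg _
  have hpos : 0 < ‖(x : H)‖ := norm_pos_iff.2 h0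
  have h1 : (inner ℂ (x : H) (T x)).im = 0 := by
    have h := congrArg Complex.im (inner_conj_symm (𝕜 := ℂ) (x : H) (T x))
    rw [hsymm x x] at h
    simp only [conj_im] at h
    linarith
  have h2 : (inner ℂ (x : H) (T x - z • (x : H))).im = -(z.im * ‖(x : H)‖ ^ 2) := by
    rw [inner_sub_right, inner_smul_right, inner_self_eq_norm_sq_to_K, sub_im, h1]
    simp only [coe_algebraMap, ← ofReal_pow, im_mul_ofReal, zero_sub]
  have h3 : |z.im| * ‖(x : H)‖ ^ 2 ≤ ‖(x : H)‖ * ‖T x - z • (x : H)‖ := by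
    refine le_trans ?_ (norm_inner_le_norm (𝕜 := ℂ) _ _)
    refine le_trans (le_of_eq ?_) (abs_im_le_norm _)
    rw [h2, abs_neg, abs_mul, abs_of_nonneg (sq_nonneg ‖(x : H)‖)]
  nlinarith

lemma mem_resolventSet_of_surjective_sub {T : H →ₗ.[ℂ] H} (hsymm : T.IsFormalAdjoint T) {z : ℂ}
    (hz : z.im ≠ 0) (hsurj : ∀ y, ∃ x : T.domain, T x - z • (x : H) = y) :
    z ∈ resolventSet T := by
  have hz' : 0 < |z.im| := abs_pos.2 hz
  let L : T.domain →ₗ[ℂ] H := T.toFun - z • T.domain.subtype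
  have hL : ∀ x, L x = T x - z • (x : H) := fun x => rfl
  have hinj : Function.Injective L := by
    rw [injective_iff_map_eq_zero]
    intro x hx
    have := abs_im_mul_norm_le hsymm z x
    rw [← hL, hx, norm_zero] at this
    have h0 : ‖(x : H)‖ ≤ 0 := by
      by_contra h
      push Not at h
      nlinarith [mul_pos hz' h]
    exact Subtype.ext (norm_le_zero_iff.1 h0)
  let e := LinearEquiv.ofBijective L ⟨hinj, hsurj⟩
  have he : ∀ y, L (e.symm y) = y := fun y => e.apply_symm_apply y
  refine ⟨(T.domain.subtype ∘ₗ e.symm.toLinearMap).mkContinuous |z.im|⁻¹ fun y => ?_,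
    fun y => ⟨(e.symm y).2, he y⟩, fun x => ?_⟩
  · have := abs_im_mul_norm_le hsymm z (e.symm y)
    rw [← hL, he] at this
    rw [inv_mul_eq_div, le_div_iff₀' hz']
    exact this
  · exact congrArg Subtype.val (e.symm_apply_apply x)

/-- An approximate eigenvalue belongs to the spectrum. -/
lemma mem_spectrum_of_approx {T : H →ₗ.[ℂ] H} {z : ℂ}
    (h : ∀ ε > 0, ∃ x : T.domain, (x : H) ≠ 0 ∧ ‖T x - z • (x : H)‖ ≤ ε * ‖(x : H)‖) :
    z ∈ spectrum T := by
  rintro ⟨R, -, hR⟩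
  have hpos : 0 < ‖R‖ + 1 := by positivity
  obtain ⟨x, hx, hle⟩ := h (‖R‖ + 1)⁻¹ (by positivity)
  have hx' : 0 < ‖(x : H)‖ := norm_pos_iff.2 hx
  have h1 : ‖(x : H)‖ ≤ ‖R‖ * ((‖R‖ + 1)⁻¹ * ‖(x : H)‖) :=
    calc ‖(x : H)‖ = ‖R (T x - z • (x : H))‖ := by rw [hR]
      _ ≤ ‖R‖ * ‖T x - z • (x : H)‖ := R.le_opNorm _
      _ ≤ _ := by gcongr
  have h2 : ‖R‖ * (‖R‖ + 1)⁻¹ < 1 := by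
    rw [← div_eq_mul_inv, div_lt_one hpos]
    linarith
  nlinarith

/-- For a selfadjoint operator, the range of `T - r` with `r` real is dense as soon as `r` is not
an eigenvalue, since its orthogonal complement is the kernel of `T - r`. -/
lemma denseRange_sub_of_isSelfAdjoint [CompleteSpace H] {T : H →ₗ.[ℂ] H} (hT : IsSelfAdjoint T)
    {r : ℝ} (hr : ∀ x : T.domain, T x = (r : ℂ) • (x : H) → x = 0) :
    DenseRange (fun x : T.domain => T x - (r : ℂ) • (x : H)) := by
  let L : T.domain →ₗ[ℂ] H := T.toFun - (r : ℂ) • T.domain.subtype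
  have hrange : Set.range (fun x : T.domain => T x - (r : ℂ) • (x : H)) = L.range := rfl
  rw [DenseRange, hrange, Submodule.dense_iff_topologicalClosure_eq_top,
    Submodule.topologicalClosure_eq_top_iff, Submodule.eq_bot_iff]
  intro y hy
  rw [Submodule.mem_orthogonal'] at hy
  have hd := hT.dense_domain
  have hinner : ∀ x : T.domain, inner ℂ ((r : ℂ) • y) (x : H) = inner ℂ y (T x) := by
    intro x
    have h := hy (L x) ⟨x, rfl⟩
    change inner ℂ y (T x - (r : ℂ) • (x : H)) = 0 at h
    rw [inner_sub_right, inner_smul_right, sub_eq_zero] at h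
    rw [h, inner_smul_left, conj_ofReal]
  have hmem := LinearPMap.mem_adjoint_domain_of_exists (T := T) y ⟨_, hinner⟩
  have hval := LinearPMap.adjoint_apply_eq hd ⟨y, hmem⟩ hinner
  have hg : (y, (r : ℂ) • y) ∈ T.graph := by
    rw [← LinearPMap.isSelfAdjoint_def.1 hT, ← hval]
    exact LinearPMap.mem_graph _ (⟨y, hmem⟩ : T.adjoint.domain)
  obtain ⟨x, hx1, hx2⟩ := T.mem_graph_iff.1 hg
  simp only at hx1 hx2
  have := hr x (by rw [hx2, hx1])
  rw [← hx1, this]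
  rfl

/-- A selfadjoint operator without eigenvalues, for which every real number is an approximate
eigenvalue, has purely continuous spectrum, equal to the real line. -/
lemma spectrum_eq_range_ofReal [CompleteSpace H] {T : H →ₗ.[ℂ] H}
    (hsymm : T.IsFormalAdjoint T)
    (hsurj : ∀ z : ℂ, z.im ≠ 0 → ∀ y, ∃ x : T.domain, T x - z • (x : H) = y)
    (heig : ∀ r : ℝ, ∀ x : T.domain, T x = (r : ℂ) • (x : H) → x = 0)
    (happrox : ∀ r : ℝ, ∀ ε > 0, ∃ x : T.domain,
      (x : H) ≠ 0 ∧ ‖T x - (r : ℂ) • (x : H)‖ ≤ ε * ‖(x : H)‖) :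
    spectrum T = Set.range ((↑) : ℝ → ℂ) ∧
      continuousSpectrum T = Set.range ((↑) : ℝ → ℂ) := by
  have h1 : spectrum T ⊆ Set.range ((↑) : ℝ → ℂ) := by
    intro z hz
    by_contra h
    have him : z.im ≠ 0 := fun h0 => h ⟨z.re, Complex.ext (by simp) (by simp [h0])⟩
    exact hz (mem_resolventSet_of_surjective_sub hsymm him (hsurj z him))
  have h2 : Set.range ((↑) : ℝ → ℂ) ⊆ continuousSpectrum T := by
    rintro _ ⟨r, rfl⟩
    refine ⟨mem_spectrum_of_approx (happrox r), fun x y hxy => ?_,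
      denseRange_sub_of_isSelfAdjoint (isSelfAdjoint_of_surjective_sub hsymm hsurj) (heig r)⟩
    refine sub_eq_zero.1 (heig r (x - y) ?_)
    simp only at hxy
    rw [sub_eq_sub_iff_add_eq_add] at hxy
    rw [T.map_sub, Submodule.coe_sub, smul_sub, sub_eq_sub_iff_add_eq_add, hxy, add_comm]
  have h3 : continuousSpectrum T ⊆ spectrum T := fun z hz => hz.1
  exact ⟨h1.antisymm (h2.trans h3), (h3.trans h1).antisymm h2⟩

end GraphCriteria

/-! ### Multiplication operators and diagonalization -/

section Diagonalization

variable {n : ℕ}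

lemma mem_graph_mulOp {g : Space n → ℝ} {u w : L2 n} :
    (u, w) ∈ (mulOp g).graph ↔ w =ᵐ[volume] fun x => (g x : ℂ) * u x := by
  rw [LinearPMap.mem_graph_iff]
  constructor
  · rintro ⟨⟨v, hv⟩, h1, h2⟩
    simp only at h1 h2
    subst h1 h2
    exact (memLp_of_mem_mulDomain hv).coeFn_toLp
  · intro h
    have hu : u ∈ mulDomain g := (memLp_congr_ae h).1 (Lp.memLp w)
    refine ⟨⟨u, hu⟩, rfl, Lp.ext ?_⟩
    exact (memLp_of_mem_mulDomain hu).coeFn_toLp.trans h.symm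

lemma isFormalAdjoint_mulOp (g : Space n → ℝ) : (mulOp g).IsFormalAdjoint (mulOp g) := by
  rintro ⟨u, hu⟩ ⟨v, hv⟩
  rw [L2.inner_def, L2.inner_def]
  refine integral_congr_ae ?_
  filter_upwards [mem_graph_mulOp.1 (LinearPMap.mem_graph (mulOp g) ⟨u, hu⟩),
    mem_graph_mulOp.1 (LinearPMap.mem_graph (mulOp g) ⟨v, hv⟩)] with x h1 h2
  rw [h1, h2]
  simp only [RCLike.inner_apply, map_mul, conj_ofReal]
  ring

/-- Off the real axis `g - z` is bounded away from `0`, so that division by it preserves `L²`. -/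
lemma exists_mulOp_sub_smul_eq {g : Space n → ℝ} (hg : Measurable g) {z : ℂ} (hz : z.im ≠ 0)
    (y : L2 n) : ∃ x : (mulOp g).domain, mulOp g x - z • (x : L2 n) = y := by
  have hne : ∀ ξ, (g ξ : ℂ) - z ≠ 0 := fun ξ h => hz (by simpa using congrArg Complex.im h)
  have hmeas : Measurable fun ξ => ((g ξ : ℂ) - z)⁻¹ :=
    ((measurable_ofReal.comp hg).sub_const z).inv
  have hmem : MemLp (fun ξ => ((g ξ : ℂ) - z)⁻¹ * y ξ) 2 volume := by
    refine MemLp.of_le_mul (c := |z.im|⁻¹) (Lp.memLp y)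
      (hmeas.aestronglyMeasurable.mul (Lp.aestronglyMeasurable y)) (Filter.Eventually.of_forall ?_)
    intro ξ
    rw [norm_mul, norm_inv]
    gcongr
    simpa using abs_im_le_norm ((g ξ : ℂ) - z)
  have hgr : (hmem.toLp _, y + z • hmem.toLp _) ∈ (mulOp g).graph := by
    rw [mem_graph_mulOp]
    filter_upwards [hmem.coeFn_toLp, Lp.coeFn_add y (z • hmem.toLp _),
      Lp.coeFn_smul z (hmem.toLp _)] with ξ h1 h2 h3
    rw [h2, Pi.add_apply, h3, Pi.smul_apply, h1, smul_eq_mul]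
    have := hne ξ
    field_simp
    ring
  obtain ⟨x, hx1, hx2⟩ := (mulOp g).mem_graph_iff.1 hgr
  refine ⟨x, ?_⟩
  simp only at hx1 hx2
  rw [hx2, hx1, add_sub_cancel_right]

/-- If the level sets of `g` are null, multiplication by `g` has no eigenvector. -/
lemma eq_zero_of_mulOp_eq_smul {g : Space n → ℝ} (hnull : ∀ r, volume (g ⁻¹' {r}) = 0) {r : ℝ}
    {x : (mulOp g).domain} (hx : mulOp g x = (r : ℂ) • (x : L2 n)) : x = 0 := by
  refine Subtype.ext (Lp.ext ?_)
  have h1 := mem_graph_mulOp.1 (LinearPMap.mem_graph (mulOp g) x)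
  rw [hx] at h1
  have hne : ∀ᵐ ξ ∂(volume : Measure (Space n)), g ξ ≠ r := by
    rw [ae_iff]
    simpa [Set.preimage] using hnull r
  filter_upwards [h1, Lp.coeFn_smul (r : ℂ) (x : L2 n), hne,
    Lp.coeFn_zero ℂ 2 (volume : Measure (Space n))] with ξ h2 h3 h4 h5
  rw [h3, Pi.smul_apply, smul_eq_mul] at h2
  refine Eq.trans ?_ h5.symm
  by_contra h
  exact h4 (ofReal_injective (mul_right_cancel₀ h h2)).symm

/-- Indicators of sets of finite measure inside `{|g - r| ≤ ε}` are approximate eigenvectors. -/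
lemma exists_approx_mulOp {g : Space n → ℝ} (hg : Continuous g) (hsurj : Function.Surjective g)
    (r : ℝ) {ε : ℝ} (hε : 0 < ε) : ∃ x : (mulOp g).domain,
      (x : L2 n) ≠ 0 ∧ ‖mulOp g x - (r : ℂ) • (x : L2 n)‖ ≤ ε * ‖(x : L2 n)‖ := by
  obtain ⟨ξ₀, hξ₀⟩ := hsurj r
  let s : Set (Space n) := g ⁻¹' Metric.ball r ε ∩ Metric.ball ξ₀ 1
  have hopen : IsOpen s := (Metric.isOpen_ball.preimage hg).inter Metric.isOpen_ball
  have hs : s.Nonempty := ⟨ξ₀, by simpa [hξ₀] using hε, by simp⟩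
  have hfin : volume s ≠ ⊤ :=
    ((measure_mono Set.inter_subset_right).trans_lt measure_ball_lt_top).ne
  let u : L2 n := indicatorConstLp 2 hopen.measurableSet hfin (1 : ℂ)
  have hu : u =ᵐ[volume] s.indicator fun _ => (1 : ℂ) := indicatorConstLp_coeFn
  have hu0 : u ≠ 0 := by
    intro h
    have h1 : ‖u‖ = 0 := by rw [h, norm_zero]
    rw [norm_indicatorConstLp (by norm_num) (by norm_num)] at h1
    have h2 : 0 < (volume : Measure (Space n)).real s :=
      ENNReal.toReal_pos (hopen.measure_pos volume hs).ne' hfin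
    simp at h1
    exact h2.ne' h1
  have hbound : ∀ ξ, ‖((g ξ : ℂ) - r) * s.indicator (fun _ => (1 : ℂ)) ξ‖
      ≤ ε * ‖s.indicator (fun _ => (1 : ℂ)) ξ‖ := by
    intro ξ
    rw [norm_mul]
    by_cases h : ξ ∈ s
    · gcongr
      rw [← ofReal_sub, norm_real]
      exact (mem_ball_iff_norm.1 h.1).le
    · simp [Set.indicator_of_notMem h]
  have hmem : MemLp (fun ξ => ((g ξ : ℂ) - r) * u ξ) 2 volume := by
    refine MemLp.of_le_mul (c := ε) (Lp.memLp u) ?_ ?_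
    · exact ((continuous_ofReal.comp hg).sub continuous_const).aestronglyMeasurable.mul
        (Lp.aestronglyMeasurable u)
    · filter_upwards [hu] with ξ h
      rw [h]
      exact hbound ξ
  have hgr : (u, hmem.toLp _ + (r : ℂ) • u) ∈ (mulOp g).graph := by
    rw [mem_graph_mulOp]
    filter_upwards [hmem.coeFn_toLp, Lp.coeFn_add (hmem.toLp _) ((r : ℂ) • u),
      Lp.coeFn_smul (r : ℂ) u] with ξ h1 h2 h3
    rw [h2, Pi.add_apply, h3, Pi.smul_apply, h1, smul_eq_mul]
    ring
  obtain ⟨x, hx1, hx2⟩ := (mulOp g).mem_graph_iff.1 hgr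
  simp only at hx1 hx2
  refine ⟨x, hx1 ▸ hu0, ?_⟩
  rw [hx2, hx1, add_sub_cancel_right]
  refine Lp.norm_le_mul_norm_of_ae_le_mul ?_
  filter_upwards [hmem.coeFn_toLp, hu] with ξ h1 h2
  rw [h1, h2]
  exact hbound ξ

/-- The unitary map `W` diagonalizes `T` as multiplication by `g`: the graph of `T` is the preimage
under `W × W` of the graph of `mulOp g`, so the domains correspond as well. -/
def IsDiagonalizedBy (T : L2 n →ₗ.[ℂ] L2 n) (W : L2 n ≃ₗᵢ[ℂ] L2 n) (g : Space n → ℝ) : Prop :=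
  ∀ x y : L2 n, (x, y) ∈ T.graph ↔ (W x, W y) ∈ (mulOp g).graph

namespace IsDiagonalizedBy

variable {T : L2 n →ₗ.[ℂ] L2 n} {W : L2 n ≃ₗᵢ[ℂ] L2 n} {g : Space n → ℝ}

lemma exists_apply_eq (h : IsDiagonalizedBy T W g) (x : T.domain) :
    ∃ x' : (mulOp g).domain, (x' : L2 n) = W x ∧ mulOp g x' = W (T x) :=
  (mulOp g).mem_graph_iff.1 ((h _ _).1 (T.mem_graph x))

lemma exists_apply_symm_eq (h : IsDiagonalizedBy T W g) (x' : (mulOp g).domain) :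
    ∃ x : T.domain, (x' : L2 n) = W x ∧ mulOp g x' = W (T x) := by
  have h1 : (W.symm x', W.symm (mulOp g x')) ∈ T.graph := by
    rw [h, W.apply_symm_apply, W.apply_symm_apply]
    exact LinearPMap.mem_graph _ x'
  obtain ⟨x, hx1, hx2⟩ := T.mem_graph_iff.1 h1
  simp only at hx1 hx2
  exact ⟨x, by rw [hx1, W.apply_symm_apply], by rw [hx2, W.apply_symm_apply]⟩

lemma isFormalAdjoint (h : IsDiagonalizedBy T W g) : T.IsFormalAdjoint T := by
  intro x y
  obtain ⟨x', hx, hx'⟩ := h.exists_apply_eq x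
  obtain ⟨y', hy, hy'⟩ := h.exists_apply_eq y
  rw [← W.inner_map_map (T x), ← W.inner_map_map (x : L2 n), ← hx, ← hy, ← hx', ← hy']
  exact isFormalAdjoint_mulOp g x' y'

lemma surjective_sub (h : IsDiagonalizedBy T W g) (hg : Measurable g) (z : ℂ) (hz : z.im ≠ 0)
    (y : L2 n) : ∃ x : T.domain, T x - z • (x : L2 n) = y := by
  obtain ⟨x', hx'⟩ := exists_mulOp_sub_smul_eq hg hz (W y)
  obtain ⟨x, h1, h2⟩ := h.exists_apply_symm_eq x'
  refine ⟨x, W.injective ?_⟩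
  rw [map_sub, map_smul, ← h1, ← h2, hx']

lemma isSelfAdjoint (h : IsDiagonalizedBy T W g) (hg : Measurable g) : IsSelfAdjoint T :=
  isSelfAdjoint_of_surjective_sub h.isFormalAdjoint (h.surjective_sub hg)

lemma spectrum_eq (h : IsDiagonalizedBy T W g) (hg : Continuous g) (hsurj : Function.Surjective g)
    (hnull : ∀ r, volume (g ⁻¹' {r}) = 0) :
    spectrum T = Set.range ((↑) : ℝ → ℂ) ∧
      continuousSpectrum T = Set.range ((↑) : ℝ → ℂ) := by
  refine spectrum_eq_range_ofReal h.isFormalAdjoint (h.surjective_sub hg.measurable) ?_ ?_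
  · intro r x hx
    obtain ⟨x', h1, h2⟩ := h.exists_apply_eq x
    have h3 : x' = 0 := eq_zero_of_mulOp_eq_smul hnull (by rw [h2, hx, map_smul, h1])
    rw [h3] at h1
    exact Subtype.ext (W.injective (by rw [← h1, Submodule.coe_zero, Submodule.coe_zero, map_zero]))
  · intro r ε hε
    obtain ⟨x', h1, h2⟩ := exists_approx_mulOp hg hsurj r hε
    obtain ⟨x, h3, h4⟩ := h.exists_apply_symm_eq x'
    refine ⟨x, fun h0 => h1 (by rw [h3, h0, map_zero]), ?_⟩
    rw [← W.norm_map, ← W.norm_map (x : L2 n), map_sub, map_smul, ← h3, ← h4]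
    exact h2

end IsDiagonalizedBy

lemma isDiagonalizedBy_mulOp (g : Space n → ℝ) :
    IsDiagonalizedBy (mulOp g) (LinearIsometryEquiv.refl ℂ (L2 n)) g := fun _ _ => Iff.rfl

lemma volume_coordinate_eq (α : Fin n) (r : ℝ) : volume ((fun x : Space n => x α) ⁻¹' {r}) = 0 := by
  have hm : MeasurableSet {y : Fin n → ℝ | y α = r} :=
    measurableSet_eq_fun (by fun_prop) (by fun_prop)
  have h := (PiLp.volume_preserving_ofLp (Fin n)).measure_preimage hm.nullMeasurableSet
  rw [volume_pi, Measure.pi_hyperplane] at h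
  exact h

end Diagonalization

/-! ### Weighted composition with a diffeomorphism -/

section WeightedComposition

variable {n : ℕ}

lemma C3Diffeo.contDiff (f : C3Diffeo n) : ContDiff ℝ 3 f := f.contMDiff.contDiff

lemma C3Diffeo.differentiable (f : C3Diffeo n) : Differentiable ℝ f :=
  f.contDiff.differentiable (by norm_num)

lemma C3Diffeo.continuous (f : C3Diffeo n) : Continuous f := f.contDiff.continuous

lemma C3Diffeo.fderiv_apply_fderiv_symm (f : C3Diffeo n) (x v : Space n) :
    fderiv ℝ f x (fderiv ℝ f.symm (f x) v) = v := by
  have h1 : HasFDerivAt (f ∘ f.symm)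
      ((fderiv ℝ f x).comp (fderiv ℝ f.symm (f x))) (f x) := by
    refine HasFDerivAt.comp (f x) ?_ (C3Diffeo.differentiable f.symm (f x)).hasFDerivAt
    rw [f.symm_apply_apply]
    exact (f.differentiable x).hasFDerivAt
  have h2 : (f ∘ f.symm : Space n → Space n) = id := funext f.apply_symm_apply
  rw [h2] at h1
  exact congrArg (fun A : Space n →L[ℝ] Space n => A v) (h1.unique (hasFDerivAt_id (f x)))

lemma C3Diffeo.det_fderiv_ne_zero (f : C3Diffeo n) (x : Space n) : (fderiv ℝ f x).det ≠ 0 := by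
  intro h0
  have h1 : (fderiv ℝ f x).comp (fderiv ℝ f.symm (f x)) = ContinuousLinearMap.id ℝ _ :=
    ContinuousLinearMap.ext fun v => f.fderiv_apply_fderiv_symm x v
  have h2 := congrArg ContinuousLinearMap.det h1
  simp only [ContinuousLinearMap.det, ContinuousLinearMap.toLinearMap_comp,
    LinearMap.det_comp, ContinuousLinearMap.coe_id, LinearMap.det_id] at h2 h0
  rw [h0, zero_mul] at h2
  exact zero_ne_one h2

lemma contDiff_det_fderiv (f : C3Diffeo n) : ContDiff ℝ 2 fun x => (fderiv ℝ f x).det := by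
  have h1 : ∀ i j : Fin n, ContDiff ℝ 2 fun x => fderiv ℝ f x (EuclideanSpace.single j 1) i :=
    fun i j => (EuclideanSpace.proj (𝕜 := ℝ) i).contDiff.comp
      ((f.contDiff.fderiv_right (by norm_num)).clm_apply contDiff_const)
  have h2 : (fun x => (fderiv ℝ f x).det) = fun x =>
      Matrix.det (Matrix.of fun i j : Fin n => fderiv ℝ f x (EuclideanSpace.single j 1) i) := by
    funext x
    rw [ContinuousLinearMap.det,
      ← LinearMap.det_toMatrix (EuclideanSpace.basisFun (Fin n) ℝ).toBasis]
    congr 1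
  rw [h2]
  simp only [Matrix.det_apply]
  refine ContDiff.sum fun σ _ => ContDiff.const_smul _ (contDiff_prod fun i _ => ?_)
  exact h1 (σ i) i

/-- The Jacobian density `|det Df|`. -/
def jacobian (f : C3Diffeo n) (x : Space n) : ℝ := |(fderiv ℝ f x).det|

lemma jacobian_pos (f : C3Diffeo n) (x : Space n) : 0 < jacobian f x :=
  abs_pos.2 (f.det_fderiv_ne_zero x)

lemma contDiff_jacobian (f : C3Diffeo n) : ContDiff ℝ 2 (jacobian f) :=
  contDiff_iff_contDiffAt.2 fun x =>
    (contDiffAt_abs (f.det_fderiv_ne_zero x)).comp x (contDiff_det_fderiv f).contDiffAt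

/-- The weight `|det Df|^{1/2}` which makes composition with `f` unitary in `L²`. -/
def weight (f : C3Diffeo n) (x : Space n) : ℝ := √(jacobian f x)

lemma weight_pos (f : C3Diffeo n) (x : Space n) : 0 < weight f x :=
  Real.sqrt_pos.2 (jacobian_pos f x)

lemma contDiff_weight (f : C3Diffeo n) : ContDiff ℝ 2 (weight f) :=
  (contDiff_jacobian f).sqrt fun x => (jacobian_pos f x).ne'

lemma C3Diffeo.quasiMeasurePreserving (f : C3Diffeo n) :
    Measure.QuasiMeasurePreserving f (volume : Measure (Space n)) volume := by
  refine ⟨f.continuous.measurable, Measure.AbsolutelyContinuous.mk fun s hs h0 => ?_⟩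
  rw [Measure.map_apply f.continuous.measurable hs]
  have h1 : f ⁻¹' s = f.symm '' s := (f.toEquiv.image_symm_eq_preimage s).symm
  rw [h1]
  exact addHaar_image_eq_zero_of_differentiableOn_of_addHaar_eq_zero volume
    (C3Diffeo.differentiable f.symm).differentiableOn h0

lemma lintegral_jacobian_mul (f : C3Diffeo n) (g : Space n → ENNReal) :
    ∫⁻ x, ENNReal.ofReal (jacobian f x) * g (f x) = ∫⁻ X, g X := by
  have h := lintegral_image_eq_lintegral_abs_det_fderiv_mul volume MeasurableSet.univ
    (fun x _ => (f.differentiable x).hasFDerivAt.hasFDerivWithinAt) (EquivLike.injective f).injOn g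
  rw [Set.image_univ, (EquivLike.surjective f).range_eq, setLIntegral_univ, setLIntegral_univ] at h
  exact h.symm

lemma integral_jacobian_smul (f : C3Diffeo n) {E : Type*} [NormedAddCommGroup E] [NormedSpace ℝ E]
    (g : Space n → E) : ∫ x, jacobian f x • g (f x) = ∫ X, g X := by
  have h := integral_image_eq_integral_abs_det_fderiv_smul volume MeasurableSet.univ
    (fun x _ => (f.differentiable x).hasFDerivAt.hasFDerivWithinAt) (EquivLike.injective f).injOn g
  rw [Set.image_univ, (EquivLike.surjective f).range_eq, setIntegral_univ, setIntegral_univ] at h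
  exact h.symm

/-- The weighted composition `v ↦ |det Df|^{1/2} (v ∘ f)` acting on functions. -/
def pullback (f : C3Diffeo n) (v : Space n → ℂ) (x : Space n) : ℂ := (weight f x : ℂ) * v (f x)

lemma pullback_congr_ae (f : C3Diffeo n) {v w : Space n → ℂ} (h : v =ᵐ[volume] w) :
    pullback f v =ᵐ[volume] pullback f w := by
  filter_upwards [f.quasiMeasurePreserving.ae_eq_comp h] with x hx
  exact congrArg ((weight f x : ℂ) * ·) hx

/-- The weight compensates the change of variables `X = f(x)` in the `L²` norm. -/
lemma eLpNorm_pullback (f : C3Diffeo n) (v : Space n → ℂ) :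
    eLpNorm (pullback f v) 2 volume = eLpNorm v 2 volume := by
  rw [eLpNorm_eq_lintegral_rpow_enorm_toReal (by norm_num) (by norm_num),
    eLpNorm_eq_lintegral_rpow_enorm_toReal (by norm_num) (by norm_num),
    ← lintegral_jacobian_mul f fun X => ‖v X‖ₑ ^ (2 : ENNReal).toReal]
  congr 1
  refine lintegral_congr fun x => ?_
  have h : ‖(weight f x : ℂ)‖ₑ ^ (2 : ENNReal).toReal = ENNReal.ofReal (jacobian f x) := by
    rw [← ofReal_norm, norm_real, Real.norm_of_nonneg (weight_pos f x).le,
      ENNReal.ofReal_rpow_of_pos (weight_pos f x)]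
    congr 1
    simp [weight, Real.sq_sqrt (jacobian_pos f x).le]
  rw [pullback, enorm_mul, ENNReal.mul_rpow_of_nonneg _ _ (by norm_num), h]

lemma contDiff_pullback (f : C3Diffeo n) {v : Space n → ℂ} (hv : ContDiff ℝ 1 v) :
    ContDiff ℝ 1 (pullback f v) :=
  (ofRealCLM.contDiff.comp ((contDiff_weight f).of_le (by norm_num))).mul
    (hv.comp (f.contDiff.of_le (by norm_num)))

lemma hasCompactSupport_pullback (f : C3Diffeo n) {v : Space n → ℂ} (hv : HasCompactSupport v) :
    HasCompactSupport (pullback f v) :=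
  (hv.comp_homeomorph f.toHomeomorph).mul_left

lemma memLp_pullback (f : C3Diffeo n) {v : Space n → ℂ} (hv : MemLp v 2 volume) :
    MemLp (pullback f v) 2 volume := by
  refine ⟨?_, by rw [eLpNorm_pullback]; exact hv.2⟩
  exact (continuous_ofReal.comp (contDiff_weight f).continuous).aestronglyMeasurable.mul
    (hv.1.comp_quasiMeasurePreserving f.quasiMeasurePreserving)

/-- The weighted composition as a linear isometry of `L²(ℝⁿ)`. -/
def pullbackIsometry (f : C3Diffeo n) : L2 n →ₗᵢ[ℂ] L2 n where
  toFun v := (memLp_pullback f (Lp.memLp v)).toLp (pullback f v)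
  map_add' u v := by
    rw [← MemLp.toLp_add]
    refine MemLp.toLp_congr _ _ ((pullback_congr_ae f (Lp.coeFn_add u v)).trans ?_)
    exact Filter.Eventually.of_forall fun x => mul_add _ _ _
  map_smul' c u := by
    refine Eq.trans (MemLp.toLp_congr _ ((memLp_pullback f (Lp.memLp u)).const_smul c)
      ((pullback_congr_ae f (Lp.coeFn_smul c u)).trans ?_)) (MemLp.toLp_const_smul c _)
    exact Filter.Eventually.of_forall fun x => mul_left_comm _ _ _
  norm_map' v := by
    change ‖(memLp_pullback f (Lp.memLp v)).toLp (pullback f v)‖ = ‖v‖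
    rw [Lp.norm_toLp, eLpNorm_pullback, Lp.norm_def]

lemma pullbackIsometry_toLp (f : C3Diffeo n) {v : Space n → ℂ} (hv : MemLp v 2 volume) :
    pullbackIsometry f (hv.toLp v) = (memLp_pullback f hv).toLp (pullback f v) :=
  MemLp.toLp_congr (memLp_pullback f (Lp.memLp _)) _ (pullback_congr_ae f hv.coeFn_toLp)

/-- The function whose weighted composition with `f` is `u`. -/
def pushforward (f : C3Diffeo n) (u : Space n → ℂ) (X : Space n) : ℂ :=
  (((weight f (f.symm X))⁻¹ : ℝ) : ℂ) * u (f.symm X)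

lemma pullback_pushforward (f : C3Diffeo n) (u : Space n → ℂ) :
    pullback f (pushforward f u) = u := by
  funext x
  have h : (weight f x : ℂ) ≠ 0 := ofReal_ne_zero.2 (weight_pos f x).ne'
  rw [pullback, pushforward, f.symm_apply_apply, ofReal_inv, mul_inv_cancel_left₀ h]

lemma contDiff_pushforward (f : C3Diffeo n) {u : Space n → ℂ} (hu : ContDiff ℝ 1 u) :
    ContDiff ℝ 1 (pushforward f u) := by
  have h1 : ContDiff ℝ 1 f.symm := f.symm.contDiff.of_le (by norm_num)
  have h2 : ContDiff ℝ 1 fun x => (weight f x)⁻¹ :=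
    ((contDiff_weight f).of_le (by norm_num)).inv fun x => (weight_pos f x).ne'
  exact (ofRealCLM.contDiff.comp (h2.comp h1)).mul (hu.comp h1)

lemma hasCompactSupport_pushforward (f : C3Diffeo n) {u : Space n → ℂ} (hu : HasCompactSupport u) :
    HasCompactSupport (pushforward f u) :=
  (hu.comp_homeomorph f.symm.toHomeomorph).mul_left

/-- The isometry is onto: its range is closed and contains the smooth compactly supported
functions. -/
lemma pullbackIsometry_surjective (f : C3Diffeo n) : Function.Surjective (pullbackIsometry f) := by
  have hclosed : IsClosed (Set.range (pullbackIsometry f)) :=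
    (pullbackIsometry f).isometry.isClosedEmbedding.isClosed_range
  have hdense : Dense (Set.range (pullbackIsometry f)) := by
    refine (Lp.dense_hasCompactSupport_contDiff (F := ℂ) (p := 2)
      (μ := (volume : Measure (Space n))) (by norm_num)).mono ?_
    rintro u ⟨g, hg, hgs, hgd⟩
    have hc : Continuous (pushforward f g) :=
      (contDiff_pushforward f (hgd.of_le (mod_cast le_top))).continuous
    have hm : MemLp (pushforward f g) 2 volume :=
      hc.memLp_of_hasCompactSupport (hasCompactSupport_pushforward f hgs)
    refine ⟨hm.toLp _, ?_⟩
    rw [pullbackIsometry_toLp]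
    refine Lp.ext ((MemLp.coeFn_toLp _).trans ?_)
    rw [pullback_pushforward]
    exact hg.symm
  intro u
  have := hclosed.closure_eq ▸ hdense u
  exact this

/-- The weighted composition as a unitary operator of `L²(ℝⁿ)`. -/
def pullbackUnitary (f : C3Diffeo n) : L2 n ≃ₗᵢ[ℂ] L2 n :=
  LinearIsometryEquiv.ofSurjective (pullbackIsometry f) (pullbackIsometry_surjective f)

lemma pullbackUnitary_toLp (f : C3Diffeo n) {v : Space n → ℂ} (hv : MemLp v 2 volume) :
    pullbackUnitary f (hv.toLp v) = (memLp_pullback f hv).toLp (pullback f v) :=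
  pullbackIsometry_toLp f hv

end WeightedComposition

/-! ### The symmetrized momentum in the coordinates `X = f(x)` -/

section TransportedMomentum

variable {n : ℕ}

/-- The first order differential expression `-i (a · ∇ + d / 2)`, which is symmetric when
`d = div a`. -/
def firstOrderOp (a : Space n → Space n) (d : Space n → ℝ) (u : Space n → ℂ) (x : Space n) : ℂ :=
  -I * (fderiv ℝ u x (a x) + ((d x / 2 : ℝ) : ℂ) * u x)

/-- The coordinate vector field `∂/∂X_α` of the coordinates `X = f(x)`, with components
`∂x_β/∂X_α`. -/
def coordField (f : C3Diffeo n) (α : Fin n) (x : Space n) : Space n :=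
  fderiv ℝ f.symm (f x) (EuclideanSpace.single α 1)

/-- The divergence of the coordinate vector field `∂/∂X_α`. -/
def coordDiv (f : C3Diffeo n) (α : Fin n) (x : Space n) : ℝ :=
  ∑ β : Fin n, partialDeriv β (fun y => coordField f α y β) x

lemma sum_smul_single (v : Space n) :
    ∑ β : Fin n, v β • EuclideanSpace.single β (1 : ℝ) = v := by
  have h := (EuclideanSpace.basisFun (Fin n) ℝ).sum_repr v
  simpa using h

lemma fderiv_apply_eq_sum {F : Type*} [NormedAddCommGroup F] [NormedSpace ℝ F] (u : Space n → F)
    (x v : Space n) : fderiv ℝ u x v = ∑ β : Fin n, v β • partialDeriv β u x := by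
  conv_lhs => rw [← sum_smul_single v, map_sum]
  simp only [map_smul, partialDeriv]

lemma contDiff_coordField (f : C3Diffeo n) (α : Fin n) : ContDiff ℝ 2 (coordField f α) := by
  have h1 : ContDiff ℝ 3 f.symm := C3Diffeo.contDiff f.symm
  have h2 : ContDiff ℝ 2 fun X => fderiv ℝ f.symm X (EuclideanSpace.single α 1) :=
    (h1.fderiv_right (by norm_num)).clm_apply contDiff_const
  exact h2.comp (f.contDiff.of_le (by norm_num))

lemma contDiff_coordField_apply (f : C3Diffeo n) (α β : Fin n) :
    ContDiff ℝ 2 fun x => coordField f α x β :=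
  (EuclideanSpace.proj (𝕜 := ℝ) β).contDiff.comp (contDiff_coordField f α)

lemma invJacobian_eq_coordField (f : C3Diffeo n) (α β : Fin n) (x : Space n) :
    invJacobian f α β x = coordField f α x β := by
  have h := (EuclideanSpace.proj (𝕜 := ℝ) β).hasFDerivAt.comp (f x)
    (C3Diffeo.differentiable f.symm (f x)).hasFDerivAt
  have h' : HasFDerivAt (fun X => f.symm X β)
    ((EuclideanSpace.proj (𝕜 := ℝ) β).comp (fderiv ℝ f.symm (f x))) (f x) := h
  rw [invJacobian, partialDeriv, h'.fderiv]
  rfl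

lemma continuous_coordDiv (f : C3Diffeo n) (α : Fin n) : Continuous (coordDiv f α) :=
  continuous_finsetSum _ fun β _ =>
    ((contDiff_coordField_apply f α β).continuous_fderiv (by norm_num)).clm_apply continuous_const

lemma symmMomentum_eq_firstOrderOp (f : C3Diffeo n) (α : Fin n) {u : Space n → ℂ}
    (hu : Differentiable ℝ u) :
    symmMomentum f α u = firstOrderOp (coordField f α) (coordDiv f α) u := by
  funext x
  have h1 : ∀ β, momentum β (fun y => (invJacobian f α β y : ℂ) * u y) x =
      -I * ((coordField f α x β : ℂ) * partialDeriv β u x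
        + ((partialDeriv β (fun y => coordField f α y β) x : ℝ) : ℂ) * u x) := by
    intro β
    simp only [invJacobian_eq_coordField, momentum, partialDeriv]
    have h2 : HasFDerivAt (fun y => ((coordField f α y β : ℝ) : ℂ))
        (ofRealCLM.comp (fderiv ℝ (fun y => coordField f α y β) x)) x :=
      ofRealCLM.hasFDerivAt.comp x
        ((contDiff_coordField_apply f α β).differentiable (by norm_num) x).hasFDerivAt
    have h3 : HasFDerivAt (fun y => ((coordField f α y β : ℝ) : ℂ) * u y) _ x :=
      h2.mul (hu x).hasFDerivAt
    rw [h3.fderiv]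
    simp [mul_comm]
  simp only [symmMomentum, h1]
  simp only [firstOrderOp, momentum, invJacobian_eq_coordField]
  rw [fderiv_apply_eq_sum, coordDiv]
  simp only [real_smul, ofReal_div, ofReal_sum, Finset.sum_div, Finset.sum_mul, mul_add,
    Finset.mul_sum, ← Finset.sum_add_distrib]
  refine Finset.sum_congr rfl fun β _ => ?_
  push_cast
  ring

lemma integral_partialDeriv_eq_zero (α : Fin n) {ψ : Space n → ℝ} (hψ : ContDiff ℝ 1 ψ)
    (hs : HasCompactSupport ψ) : ∫ x, partialDeriv α ψ x = 0 := by
  have h := integral_mul_fderiv_eq_neg_fderiv_mul_of_integrable (𝕜 := ℝ)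
    (μ := (volume : Measure (Space n))) (f := ψ) (g := fun _ => (1 : ℝ))
    (v := EuclideanSpace.single α 1) ?_ ?_ ?_
    (fun x _ => hψ.differentiable (by norm_num) x) (fun x _ => differentiableAt_const _)
  · simpa [partialDeriv] using h
  · simp only [mul_one]
    exact Continuous.integrable_of_hasCompactSupport
      ((hψ.continuous_fderiv (by norm_num)).clm_apply continuous_const) (hs.fderiv_apply ℝ _)
  · simp
  · simp only [mul_one]
    exact hψ.continuous.integrable_of_hasCompactSupport hs

/-- The Piola identity: the vector field `|det Df| ∂/∂X_α` is free of divergence. It is proved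
weakly: tested against `φ`, the change of variables `X = f(x)` turns it into the statement that
`∂(φ ∘ f⁻¹)/∂X_α` has integral zero. -/
lemma fderiv_jacobian_coordField (f : C3Diffeo n) (α : Fin n) (x : Space n) :
    fderiv ℝ (jacobian f) x (coordField f α x) + jacobian f x * coordDiv f α x = 0 := by
  set h : Space n → ℝ := fun x =>
    fderiv ℝ (jacobian f) x (coordField f α x) + jacobian f x * coordDiv f α x with hdef
  have hcont : Continuous h :=
    (((contDiff_jacobian f).continuous_fderiv (by norm_num)).clm_apply
      (contDiff_coordField f α).continuous).add
      ((contDiff_jacobian f).continuous.mul (continuous_coordDiv f α))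
  let b : Fin n → Space n → ℝ := fun β x => jacobian f x * coordField f α x β
  have hb : ∀ β, ContDiff ℝ 2 (b β) := fun β =>
    (contDiff_jacobian f).mul (contDiff_coordField_apply f α β)
  have hsum : ∀ x, h x = ∑ β, partialDeriv β (b β) x := by
    intro x
    have h1 : ∀ β, partialDeriv β (b β) x = coordField f α x β * partialDeriv β (jacobian f) x
        + jacobian f x * partialDeriv β (fun y => coordField f α y β) x := by
      intro β
      have h2 : HasFDerivAt (b β) _ x :=
        ((contDiff_jacobian f).differentiable (by norm_num) x).hasFDerivAt.mul
          ((contDiff_coordField_apply f α β).differentiable (by norm_num) x).hasFDerivAt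
      rw [partialDeriv, h2.fderiv]
      simp [partialDeriv, add_comm]
    simp only [hdef, h1, Finset.sum_add_distrib, fderiv_apply_eq_sum, smul_eq_mul, coordDiv,
      Finset.mul_sum]
  have htest : ∀ φ : Space n → ℝ, ContDiff ℝ ∞ φ → HasCompactSupport φ →
      ∫ x, φ x • h x = 0 := by
    intro φ hφ hs
    have hφ1 : ContDiff ℝ 1 φ := hφ.of_le (mod_cast le_top)
    have hdφ : ∀ β : Fin n, Continuous (partialDeriv β φ) := fun β =>
      (hφ1.continuous_fderiv (by norm_num)).clm_apply continuous_const
    have hsφ : ∀ β : Fin n, HasCompactSupport (partialDeriv β φ) := fun β =>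
      hs.fderiv_apply ℝ _
    have hdb : ∀ β : Fin n, Continuous (partialDeriv β (b β)) := fun β =>
      ((hb β).continuous_fderiv (by norm_num)).clm_apply continuous_const
    have hi1 : ∀ β, Integrable (fun x => φ x * partialDeriv β (b β) x) volume := fun β =>
      (hφ.continuous.mul (hdb β)).integrable_of_hasCompactSupport hs.mul_right
    have hi2 : ∀ β, Integrable (fun x => partialDeriv β φ x * b β x) volume := fun β =>
      ((hdφ β).mul (hb β).continuous).integrable_of_hasCompactSupport (hsφ β).mul_right
    have hparts : ∀ β, ∫ x, φ x * partialDeriv β (b β) x = -∫ x, partialDeriv β φ x * b β x :=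
      fun β => integral_mul_fderiv_eq_neg_fderiv_mul_of_integrable (hi2 β) (hi1 β)
        ((hφ.continuous.mul (hb β).continuous).integrable_of_hasCompactSupport hs.mul_right)
        (fun x _ => hφ1.differentiable (by norm_num) x)
        (fun x _ => (hb β).differentiable (by norm_num) x)
    have hψ : ContDiff ℝ 1 (φ ∘ f.symm) :=
      hφ1.comp ((C3Diffeo.contDiff f.symm).of_le (by norm_num))
    have hψs : HasCompactSupport (φ ∘ f.symm) := hs.comp_homeomorph f.symm.toHomeomorph
    -- by the chain rule, `∂(φ ∘ f⁻¹)/∂X_α` at `f x` is the derivative of `φ` along `∂/∂X_α`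
    have hchain : ∀ x, partialDeriv α (φ ∘ f.symm) (f x) = fderiv ℝ φ x (coordField f α x) := by
      intro x
      have h1 : HasFDerivAt φ (fderiv ℝ φ x) (f.symm (f x)) := by
        rw [f.symm_apply_apply]
        exact (hφ1.differentiable (by norm_num) x).hasFDerivAt
      have h2 := h1.comp (f x) (C3Diffeo.differentiable f.symm (f x)).hasFDerivAt
      rw [partialDeriv, h2.fderiv]
      rfl
    have hzero : ∫ x, ∑ β, partialDeriv β φ x * b β x = 0 := by
      rw [← integral_partialDeriv_eq_zero α hψ hψs,
        ← integral_jacobian_smul f (partialDeriv α (φ ∘ f.symm))]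
      refine integral_congr_ae (Filter.Eventually.of_forall fun x => ?_)
      simp only [hchain, fderiv_apply_eq_sum, smul_eq_mul, Finset.mul_sum, b]
      exact Finset.sum_congr rfl fun β _ => by ring
    simp only [hsum, smul_eq_mul, Finset.mul_sum]
    rw [integral_finsetSum _ fun β _ => hi1 β]
    simp only [hparts]
    rw [Finset.sum_neg_distrib, ← integral_finsetSum _ fun β _ => hi2 β, hzero, neg_zero]
  have hae : h =ᵐ[volume] fun _ => 0 :=
    ae_eq_zero_of_integral_contDiff_smul_eq_zero hcont.locallyIntegrable htest
  exact congrFun ((Continuous.ae_eq_iff_eq volume hcont continuous_const).1 hae) x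

lemma fderiv_weight_coordField (f : C3Diffeo n) (α : Fin n) (x : Space n) :
    fderiv ℝ (weight f) x (coordField f α x) = -(coordDiv f α x / 2 * weight f x) := by
  have h1 := (((contDiff_jacobian f).differentiable (by norm_num) x).hasFDerivAt.sqrt
    (jacobian_pos f x).ne')
  have h2 : HasFDerivAt (weight f) _ x := h1
  rw [h2.fderiv]
  have h3 := fderiv_jacobian_coordField f α x
  have h4 : jacobian f x = weight f x ^ 2 := (Real.sq_sqrt (jacobian_pos f x).le).symm
  have h5 := (weight_pos f x).ne'
  change (1 / (2 * weight f x)) * fderiv ℝ (jacobian f) x (coordField f α x) = _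
  rw [h4] at h3
  rw [eq_neg_of_add_eq_zero_left h3]
  field_simp

/-- In the coordinates `X = f(x)` the symmetrized momentum is `-i ∂/∂X_α`. -/
lemma firstOrderOp_pullback (f : C3Diffeo n) (α : Fin n) {v : Space n → ℂ}
    (hv : Differentiable ℝ v) :
    firstOrderOp (coordField f α) (coordDiv f α) (pullback f v)
      = pullback f (firstOrderOp (fun _ => EuclideanSpace.single α 1) (fun _ => 0) v) := by
  funext x
  have h1 : HasFDerivAt (fun y => (weight f y : ℂ)) (ofRealCLM.comp (fderiv ℝ (weight f) x)) x :=
    ofRealCLM.hasFDerivAt.comp x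
      ((contDiff_weight f).differentiable (by norm_num) x).hasFDerivAt
  have h2 : HasFDerivAt (fun y => v (f y)) ((fderiv ℝ v (f x)).comp (fderiv ℝ f x)) x :=
    (hv (f x)).hasFDerivAt.comp x (f.differentiable x).hasFDerivAt
  have h3 : HasFDerivAt (pullback f v) _ x := h1.mul h2
  simp only [firstOrderOp, h3.fderiv]
  simp only [pullback, firstOrderOp, FunLike.coe_add, Pi.add_apply, FunLike.coe_smul, Pi.smul_apply,
    ContinuousLinearMap.comp_apply, smul_eq_mul, ofRealCLM_apply]
  rw [fderiv_weight_coordField, coordField, C3Diffeo.fderiv_apply_fderiv_symm]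
  push_cast
  ring

end TransportedMomentum

/-! ### Approximation in graph norm -/

section SmoothApproximation

variable {n : ℕ}

open scoped Convolution in
/-- Mollification approximates a compactly supported `C¹` function uniformly together with its
derivative, the supports staying in a fixed compact set. -/
lemma exists_contDiff_approx_fderiv {u : Space n → ℂ} (hu : ContDiff ℝ 1 u)
    (hs : HasCompactSupport u) {ε : ℝ} (hε : 0 < ε) :
    ∃ w : Space n → ℂ, ContDiff ℝ ∞ w ∧ tsupport w ⊆ Metric.cthickening 1 (tsupport u) ∧
      (∀ x, ‖w x - u x‖ ≤ ε) ∧ ∀ x, ‖fderiv ℝ w x - fderiv ℝ u x‖ ≤ ε := by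
  have hdu : Continuous (fderiv ℝ u) := hu.continuous_fderiv (by norm_num)
  obtain ⟨δ₁, hδ₁, h1⟩ := Metric.uniformContinuous_iff.1
    (hs.uniformContinuous_of_continuous hu.continuous) ε hε
  obtain ⟨δ₂, hδ₂, h2⟩ := Metric.uniformContinuous_iff.1
    ((hs.fderiv ℝ).uniformContinuous_of_continuous hdu) ε hε
  let δ := min 1 (min δ₁ δ₂)
  have hδ : 0 < δ := by positivity
  let φ : ContDiffBump (0 : Space n) := ⟨δ / 2, δ, by positivity, by linarith⟩
  let L := ContinuousLinearMap.lsmul ℝ ℝ (E := ℂ)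
  let w : Space n → ℂ := φ.normed volume ⋆[L, volume] u
  have hloc : LocallyIntegrable (φ.normed volume) (volume : Measure (Space n)) :=
    φ.continuous_normed.locallyIntegrable
  have hderiv : ∀ x, fderiv ℝ w x =
      (φ.normed volume ⋆[ContinuousLinearMap.lsmul ℝ ℝ, volume] fderiv ℝ u) x := fun x =>
    (hs.hasFDerivAt_convolution_right L hloc hu x).fderiv
  refine ⟨w, ?_, ?_, fun x => ?_, fun x => ?_⟩
  · exact φ.hasCompactSupport_normed.contDiff_convolution_left L φ.contDiff_normed
      hu.continuous.locallyIntegrable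
  · refine closure_minimal ?_ Metric.isClosed_cthickening
    refine (support_convolution_subset L).trans ?_
    rintro _ ⟨y, hy, t, ht, rfl⟩
    rw [φ.support_normed_eq, mem_ball_zero_iff] at hy
    refine Metric.mem_cthickening_of_dist_le _ t _ _ (subset_tsupport u ht) ?_
    simp only [dist_add_self_left]
    exact hy.le.trans (min_le_left _ _)
  · rw [← dist_eq_norm]
    refine φ.dist_normed_convolution_le hu.continuous.aestronglyMeasurable fun y hy => (h1 ?_).le
    exact (Metric.mem_ball.1 hy).trans_le ((min_le_right _ _).trans (min_le_left _ _))
  · rw [hderiv, ← dist_eq_norm]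
    refine φ.dist_normed_convolution_le hdu.aestronglyMeasurable fun y hy => (h2 ?_).le
    exact (Metric.mem_ball.1 hy).trans_le ((min_le_right _ _).trans (min_le_right _ _))

lemma continuous_firstOrderOp {a : Space n → Space n} {d : Space n → ℝ} (ha : Continuous a)
    (hd : Continuous d) {u : Space n → ℂ} (hu : ContDiff ℝ 1 u) :
    Continuous (firstOrderOp a d u) :=
  continuous_const.mul (((hu.continuous_fderiv (by norm_num)).clm_apply ha).add
    ((continuous_ofReal.comp (hd.div_const 2)).mul hu.continuous))

lemma support_firstOrderOp_subset (a : Space n → Space n) (d : Space n → ℝ) (u : Space n → ℂ) :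
    Function.support (firstOrderOp a d u) ⊆ tsupport u := by
  intro x hx
  by_contra h
  refine hx ?_
  have h1 : fderiv ℝ u x = 0 :=
    image_eq_zero_of_notMem_tsupport fun h' => h (tsupport_fderiv_subset ℝ h')
  simp [firstOrderOp, h1, image_eq_zero_of_notMem_tsupport h]

lemma hasCompactSupport_firstOrderOp (a : Space n → Space n) (d : Space n → ℝ) {u : Space n → ℂ}
    (hu : HasCompactSupport u) : HasCompactSupport (firstOrderOp a d u) :=
  hu.of_isClosed_subset (isClosed_tsupport _)
    (closure_minimal (support_firstOrderOp_subset a d u) (isClosed_tsupport _))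

lemma memLp_firstOrderOp {a : Space n → Space n} {d : Space n → ℝ} (ha : Continuous a)
    (hd : Continuous d) {u : Space n → ℂ} (hu : ContDiff ℝ 1 u) (hs : HasCompactSupport u) :
    MemLp (firstOrderOp a d u) 2 volume :=
  (continuous_firstOrderOp ha hd hu).memLp_of_hasCompactSupport
    (hasCompactSupport_firstOrderOp a d hs)

/-- The smooth compactly supported functions are dense in the compactly supported `C¹` functions
for the graph norm of a first order operator with continuous coefficients. -/
lemma exists_smooth_approx_firstOrderOp {a : Space n → Space n} {d : Space n → ℝ}
    (ha : Continuous a) (hd : Continuous d) {u : Space n → ℂ} (hu : ContDiff ℝ 1 u)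
    (hs : HasCompactSupport u) {ε : ℝ} (hε : 0 < ε) :
    ∃ w : Space n → ℂ, ContDiff ℝ ∞ w ∧ HasCompactSupport w ∧
      eLpNorm (w - u) 2 volume ≤ ENNReal.ofReal ε ∧
      eLpNorm (firstOrderOp a d w - firstOrderOp a d u) 2 volume ≤ ENNReal.ofReal ε := by
  let K := Metric.cthickening 1 (tsupport u)
  have hK : IsCompact K := IsCompact.cthickening hs
  have huK : tsupport u ⊆ K := Metric.self_subset_cthickening _
  obtain ⟨C₀, hC₀⟩ := hK.exists_bound_of_continuousOn
    (f := fun x => ‖a x‖ + |d x / 2|) (by fun_prop)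
  let C := max C₀ 1
  have hC : ∀ x ∈ K, ‖a x‖ + |d x / 2| ≤ C := fun x hx =>
    ((le_abs_self _).trans (hC₀ x hx)).trans (le_max_left _ _)
  have hC1 : 1 ≤ C := le_max_right _ _
  have hCpos : 0 < C := by linarith
  have hKfin : (volume K) ^ (1 / (2 : ENNReal).toReal) ≠ ⊤ :=
    (ENNReal.rpow_lt_top_of_nonneg (by positivity) hK.measure_ne_top).ne
  let M := ((volume K) ^ (1 / (2 : ENNReal).toReal)).toReal
  have hM : 0 ≤ M := ENNReal.toReal_nonneg
  let η := ε / (C * (M + 1))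
  have hη : 0 < η := by positivity
  have hCη : 0 ≤ C * η := by positivity
  have hfinal : ENNReal.ofReal (C * η) * (volume K) ^ (1 / (2 : ENNReal).toReal)
      ≤ ENNReal.ofReal ε := by
    rw [← ENNReal.ofReal_toReal hKfin, ← ENNReal.ofReal_mul hCη]
    refine ENNReal.ofReal_le_ofReal ?_
    have h1 : C * η * (M + 1) = ε := by
      have : M + 1 ≠ 0 := by positivity
      simp only [η]
      field_simp
    change C * η * M ≤ ε
    nlinarith
  obtain ⟨w, hw, hwK, h1, h2⟩ := exists_contDiff_approx_fderiv hu hs hη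
  have hwc : HasCompactSupport w := hK.of_isClosed_subset (isClosed_tsupport _) hwK
  refine ⟨w, hw, hwc, ?_, ?_⟩
  · refine le_trans (eLpNorm_sub_le_of_dist_bdd volume (by norm_num) hK.measurableSet hCη
      (fun x => ?_) ((subset_tsupport w).trans hwK) ((subset_tsupport u).trans huK)) hfinal
    rw [dist_eq_norm]
    exact (h1 x).trans (le_mul_of_one_le_left hη.le hC1)
  · refine le_trans (eLpNorm_sub_le_of_dist_bdd volume (by norm_num) hK.measurableSet hCη
      (fun x => ?_) ((support_firstOrderOp_subset a d w).trans hwK)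
      ((support_firstOrderOp_subset a d u).trans huK)) hfinal
    by_cases hx : x ∈ K
    · have h3 : firstOrderOp a d w x - firstOrderOp a d u x = -I *
          ((fderiv ℝ w x - fderiv ℝ u x) (a x) + ((d x / 2 : ℝ) : ℂ) * (w x - u x)) := by
        simp only [firstOrderOp, FunLike.coe_sub, Pi.sub_apply]
        ring
      rw [dist_eq_norm, h3, norm_mul, norm_neg, norm_I, one_mul]
      calc _ ≤ ‖(fderiv ℝ w x - fderiv ℝ u x) (a x)‖ + ‖((d x / 2 : ℝ) : ℂ) * (w x - u x)‖ :=
            norm_add_le _ _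
        _ ≤ η * ‖a x‖ + |d x / 2| * η := by
            rw [norm_mul, norm_real, Real.norm_eq_abs]
            gcongr
            · exact ContinuousLinearMap.le_of_opNorm_le _ (h2 x) _
            · exact h1 x
        _ = (‖a x‖ + |d x / 2|) * η := by ring
        _ ≤ C * η := by gcongr; exact hC x hx
    · have h3 : firstOrderOp a d w x = 0 := by
        by_contra h
        exact hx (hwK (support_firstOrderOp_subset a d w h))
      have h4 : firstOrderOp a d u x = 0 := by
        by_contra h
        exact hx (huK (support_firstOrderOp_subset a d u h))
      rw [h3, h4, dist_self]
      exact hCη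

lemma memLp_norm_mul_schwartz (v : SchwartzMap (Space n) ℂ) :
    MemLp (fun x => ‖x‖ * ‖v x‖) 2 volume := by
  have hc : Continuous fun x => ‖x‖ * ‖v x‖ := continuous_norm.mul v.continuous.norm
  rw [memLp_two_iff_integrable_sq hc.aestronglyMeasurable]
  obtain ⟨C, hC⟩ := v.decay 0 0
  refine ((v.integrable_pow_mul volume 2).const_mul C).mono' (hc.pow 2).aestronglyMeasurable
    (Filter.Eventually.of_forall fun x => ?_)
  have h1 : ‖v x‖ ≤ C := by simpa using hC.2 x
  rw [Real.norm_of_nonneg (by positivity)]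
  have h2 : ‖x‖ ^ 2 * ‖v x‖ * ‖v x‖ ≤ ‖x‖ ^ 2 * ‖v x‖ * C := by gcongr
  linarith

/-- Smooth cutoffs at radius `R` whose directional derivatives are of order `1 / R`. -/
lemma exists_cutoff (e : Space n) : ∃ C : ℝ, ∀ R > 0, ∃ χ : Space n → ℝ, ContDiff ℝ ∞ χ ∧
    HasCompactSupport χ ∧ (∀ x, |χ x - 1| ≤ R⁻¹ * ‖x‖) ∧ ∀ x, |fderiv ℝ χ x e| ≤ R⁻¹ * C := by
  let χ : ContDiffBump (0 : Space n) := ⟨1, 2, by norm_num, by norm_num⟩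
  obtain ⟨C, hC⟩ := (χ.contDiff (n := 1)).continuous_fderiv (by norm_num) |>.clm_apply
    (continuous_const (y := e)) |>.bounded_above_of_compact_support
      (χ.hasCompactSupport.fderiv_apply ℝ e)
  refine ⟨C, fun R hR => ?_⟩
  let χR : Space n → ℝ := fun x => χ (R⁻¹ • x)
  have hχR : ContDiff ℝ ∞ χR := χ.contDiff.comp (contDiff_const_smul R⁻¹)
  have hχRs : HasCompactSupport χR :=
    χ.hasCompactSupport.comp_homeomorph (Homeomorph.smulOfNeZero R⁻¹ (by positivity))
  have hχ1 : ∀ x, |χR x - 1| ≤ R⁻¹ * ‖x‖ := by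
    intro x
    have hnn : 0 ≤ R⁻¹ * ‖x‖ := by positivity
    have hnorm : ‖R⁻¹ • x‖ = R⁻¹ * ‖x‖ := by
      rw [norm_smul, Real.norm_of_nonneg (by positivity)]
    by_cases hx : R⁻¹ * ‖x‖ ≤ 1
    · have : χR x = 1 := χ.one_of_mem_closedBall (by simpa [hnorm] using hx)
      simpa [this] using hnn
    · have h0 : 0 ≤ χR x := χ.nonneg
      have h1 : χR x ≤ 1 := χ.le_one
      rw [abs_le]
      constructor <;> linarith
  have hdχ : ∀ x, |fderiv ℝ χR x e| ≤ R⁻¹ * C := by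
    intro x
    have h1 : fderiv ℝ χR x = R⁻¹ • fderiv ℝ χ (R⁻¹ • x) := fderiv_comp_smul R⁻¹
    rw [h1, FunLike.coe_smul, Pi.smul_apply, smul_eq_mul, abs_mul,
      abs_of_nonneg (by positivity : 0 ≤ R⁻¹)]
    gcongr
    exact hC _
  exact ⟨χR, hχR, hχRs, hχ1, hdχ⟩

open LineDeriv in
/-- Cutting off at radius `R` approximates a Schwartz function by smooth compactly supported
functions in the graph norm of a directional derivative; the errors are of order `1 / R`. -/
lemma exists_smooth_approx_schwartz (v : SchwartzMap (Space n) ℂ) (e : Space n) {ε : ℝ}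
    (hε : 0 < ε) :
    ∃ w : Space n → ℂ, ContDiff ℝ ∞ w ∧ HasCompactSupport w ∧
      eLpNorm (w - ⇑v) 2 volume ≤ ENNReal.ofReal ε ∧
      eLpNorm (firstOrderOp (fun _ => e) (fun _ => 0) w - fun x => -I * (∂_{e} v) x) 2 volume
        ≤ ENNReal.ofReal ε := by
  obtain ⟨C, hcut⟩ := exists_cutoff e
  let h₁ : Space n → ℝ := fun x => ‖x‖ * ‖v x‖
  let h₂ : Space n → ℝ := fun x => ‖x‖ * ‖(∂_{e} v) x‖ + C * ‖v x‖
  have hm₁ : MemLp h₁ 2 volume := memLp_norm_mul_schwartz v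
  have hm₂ : MemLp h₂ 2 volume :=
    (memLp_norm_mul_schwartz (∂_{e} v)).add ((v.memLp 2 volume).norm.const_mul C)
  let N := (eLpNorm h₁ 2 volume).toReal + (eLpNorm h₂ 2 volume).toReal
  have hN : 0 ≤ N := by positivity
  let R := N / ε + 1
  have hR : 0 < R := by positivity
  have hNR : R⁻¹ * N ≤ ε := by
    rw [inv_mul_le_iff₀ hR]
    simp only [R]
    rw [add_mul, div_mul_cancel₀ _ hε.ne']
    linarith
  have hbound : ∀ (h : Space n → ℝ) (k : Space n → ℂ), MemLp h 2 volume →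
      (eLpNorm h 2 volume).toReal ≤ N → (∀ x, ‖k x‖ ≤ R⁻¹ * h x) →
      eLpNorm k 2 volume ≤ ENNReal.ofReal ε := by
    intro h k hm hle hk
    calc eLpNorm k 2 volume ≤ ENNReal.ofReal R⁻¹ * eLpNorm h 2 volume := by
          refine eLpNorm_le_mul_eLpNorm_of_ae_le_mul (Filter.Eventually.of_forall fun x => ?_) 2
          exact (hk x).trans (by gcongr; exact Real.le_norm_self _)
      _ = ENNReal.ofReal (R⁻¹ * (eLpNorm h 2 volume).toReal) := by
          rw [ENNReal.ofReal_mul (by positivity), ENNReal.ofReal_toReal hm.2.ne]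
      _ ≤ ENNReal.ofReal ε := by
          refine ENNReal.ofReal_le_ofReal (le_trans ?_ hNR)
          gcongr
  obtain ⟨χR, hχR, hχRs, hχ1, hdχ⟩ := hcut R hR
  have hv : ContDiff ℝ ∞ v := v.smooth ⊤
  have hdv : ∀ x, (∂_{e} v) x = fderiv ℝ v x e := fun x => rfl
  refine ⟨fun x => (χR x : ℂ) * v x, (ofRealCLM.contDiff.comp hχR).mul hv, ?_, ?_, ?_⟩
  · exact (hχRs.comp_left (g := ((↑) : ℝ → ℂ)) ofReal_zero).mul_right
  · refine hbound h₁ _ hm₁ (le_add_of_nonneg_right (by positivity)) fun x => ?_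
    have h1 : (χR x : ℂ) * v x - v x = ((χR x - 1 : ℝ) : ℂ) * v x := by push_cast; ring
    simp only [Pi.sub_apply]
    rw [h1, norm_mul, norm_real, Real.norm_eq_abs]
    calc _ ≤ R⁻¹ * ‖x‖ * ‖v x‖ := by gcongr; exact hχ1 x
      _ = R⁻¹ * h₁ x := by simp only [h₁]; ring
  · refine hbound h₂ _ hm₂ (le_add_of_nonneg_left (by positivity)) fun x => ?_
    have hχd : HasFDerivAt (fun y => (χR y : ℂ)) (ofRealCLM.comp (fderiv ℝ χR x)) x :=
      ofRealCLM.hasFDerivAt.comp x (hχR.differentiable (by norm_num) x).hasFDerivAt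
    have hd : HasFDerivAt (fun x => (χR x : ℂ) * v x) _ x :=
      hχd.mul (hv.differentiable (by norm_num) x).hasFDerivAt
    have h1 : firstOrderOp (fun _ => e) (fun _ => 0) (fun x => (χR x : ℂ) * v x) x
        - -I * (∂_{e} v) x = -I * (((χR x - 1 : ℝ) : ℂ) * (∂_{e} v) x
          + (fderiv ℝ χR x e : ℂ) * v x) := by
      simp only [firstOrderOp, hd.fderiv, hdv]
      simp
      ring
    simp only [Pi.sub_apply]
    rw [h1, norm_mul, norm_neg, norm_I, one_mul]
    refine (norm_add_le _ _).trans ?_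
    rw [norm_mul, norm_mul, norm_real, norm_real, Real.norm_eq_abs, Real.norm_eq_abs]
    calc _ ≤ R⁻¹ * ‖x‖ * ‖(∂_{e} v) x‖ + R⁻¹ * C * ‖v x‖ := by
          gcongr
          · exact hχ1 x
          · exact hdχ x
      _ = R⁻¹ * h₂ x := by simp only [h₂]; ring

end SmoothApproximation

/-! ### Diagonalization of the symmetrized momentum -/

section FourierDiagonalization

variable {n : ℕ}

/-- A pair of `L²` functions belongs to a closed set as soon as it can be approximated by pairs in
this set, with errors measured on representatives. -/
lemma toLp_prod_mem_of_approx {G : Set (L2 n × L2 n)} (hG : IsClosed G) {u u' : Space n → ℂ}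
    (hu : MemLp u 2 volume) (hu' : MemLp u' 2 volume)
    (h : ∀ ε : ℝ, 0 < ε → ∃ (w w' : Space n → ℂ) (hw : MemLp w 2 volume) (hw' : MemLp w' 2 volume),
      (hw.toLp w, hw'.toLp w') ∈ G ∧ eLpNorm (w - u) 2 volume ≤ ENNReal.ofReal ε ∧
        eLpNorm (w' - u') 2 volume ≤ ENNReal.ofReal ε) :
    (hu.toLp u, hu'.toLp u') ∈ G := by
  rw [← hG.closure_eq, Metric.mem_closure_iff]
  intro ε hε
  obtain ⟨w, w', hw, hw', hmem, h1, h2⟩ := h (ε / 2) (by positivity)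
  refine ⟨_, hmem, ?_⟩
  have hdist : ∀ {v v' : Space n → ℂ} (hv : MemLp v 2 volume) (hv' : MemLp v' 2 volume),
      eLpNorm (v' - v) 2 volume ≤ ENNReal.ofReal (ε / 2) → dist (hv.toLp v) (hv'.toLp v') < ε := by
    intro v v' hv hv' hle
    rw [dist_comm, dist_edist, Lp.edist_toLp_toLp]
    refine (ENNReal.toReal_le_of_le_ofReal (by positivity) hle).trans_lt (by linarith)
  rw [Prod.dist_eq]
  exact max_lt (hdist hu hw h1) (hdist hu' hw' h2)

/-- The symbol `2π ξ_α` of `-i ∂/∂X_α` under the Fourier transform. -/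
def symbol (α : Fin n) (ξ : Space n) : ℝ := 2 * Real.pi * ξ α

lemma contDiff_symbol (α : Fin n) : ContDiff ℝ ∞ (symbol α) :=
  contDiff_const.mul (EuclideanSpace.proj (𝕜 := ℝ) α).contDiff

lemma symbol_surjective (α : Fin n) : Function.Surjective (symbol α) := by
  intro r
  refine ⟨EuclideanSpace.single α (r / (2 * Real.pi)), ?_⟩
  have := Real.pi_ne_zero
  simp only [symbol, PiLp.single_apply, if_true]
  field_simp

lemma volume_symbol_preimage (α : Fin n) (r : ℝ) : volume (symbol α ⁻¹' {r}) = 0 := by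
  have h : symbol α ⁻¹' {r} = (fun x : Space n => x α) ⁻¹' {r / (2 * Real.pi)} := by
    ext ξ
    have := Real.pi_pos
    simp only [symbol, Set.mem_preimage, Set.mem_singleton_iff]
    rw [eq_div_iff (by positivity), mul_comm]
  rw [h, volume_coordinate_eq]

open LineDeriv FourierTransform in
/-- On Schwartz functions the Fourier transform turns `-i ∂/∂X_α` into multiplication by
`2π ξ_α`. -/
lemma fourier_lineDeriv_mem_graph (α : Fin n) (v : SchwartzMap (Space n) ℂ) :
    (Lp.fourierTransformₗᵢ (Space n) ℂ (v.toLp 2 volume),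
      Lp.fourierTransformₗᵢ (Space n) ℂ
        ((-I • ∂_{EuclideanSpace.single α (1 : ℝ)} v).toLp 2 volume))
      ∈ (mulOp (symbol α)).graph := by
  have h1 : ∀ s : SchwartzMap (Space n) ℂ,
      Lp.fourierTransformₗᵢ (Space n) ℂ (s.toLp 2 volume) = (𝓕 s).toLp 2 volume :=
    fun s => SchwartzMap.toLp_fourier_eq s
  rw [mem_graph_mulOp, h1, h1, FourierTransform.fourier_smul, SchwartzMap.fourier_lineDerivOp_eq]
  have htg : (fun ξ : Space n => inner ℝ ξ (EuclideanSpace.single α (1 : ℝ))).HasTemperateGrowth :=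
    ((innerSL ℝ).flip _).hasTemperateGrowth
  filter_upwards [SchwartzMap.coeFn_toLp (𝓕 v) 2 volume, SchwartzMap.coeFn_toLp
    (-I • (2 * Real.pi * I) • SchwartzMap.smulLeftCLM ℂ
      (fun ξ : Space n => inner ℝ ξ (EuclideanSpace.single α (1 : ℝ))) (𝓕 v)) 2 volume]
    with ξ h2 h3
  rw [h2, h3]
  simp only [_root_.smul_apply, SchwartzMap.smulLeftCLM_apply_apply htg]
  simp only [EuclideanSpace.inner_single_right, symbol]
  simp only [smul_eq_mul, real_smul]
  push_cast
  simp
  linear_combination (-(2 * Real.pi * ξ α * 𝓕 v ξ) : ℂ) * I_sq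

lemma isClosed_graph_mulOp {g : Space n → ℝ} (hg : Measurable g) :
    IsClosed ((mulOp g).graph : Set (L2 n × L2 n)) :=
  ((isDiagonalizedBy_mulOp g).isSelfAdjoint hg).isClosed

/-- The operator `-i ∂/∂X_α` acting on functions. -/
abbrev momentumOp (α : Fin n) : (Space n → ℂ) → Space n → ℂ :=
  firstOrderOp (fun _ => EuclideanSpace.single α 1) fun _ => 0

lemma memLp_momentumOp (α : Fin n) {v : Space n → ℂ} (hv : ContDiff ℝ 1 v)
    (hs : HasCompactSupport v) : MemLp (momentumOp α v) 2 volume :=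
  memLp_firstOrderOp continuous_const continuous_const hv hs

/-- The relation between `-i ∂/∂X_α` and multiplication by `2π ξ_α` extends to
compactly supported `C¹` functions, because the graph of a multiplication operator is closed. -/
lemma fourier_momentumOp_mem_graph (α : Fin n) {v : Space n → ℂ} (hv : ContDiff ℝ 1 v)
    (hs : HasCompactSupport v) (hm : MemLp v 2 volume) (hm' : MemLp (momentumOp α v) 2 volume) :
    (Lp.fourierTransformₗᵢ (Space n) ℂ (hm.toLp v),
      Lp.fourierTransformₗᵢ (Space n) ℂ (hm'.toLp (momentumOp α v)))
      ∈ (mulOp (symbol α)).graph := by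
  let F := Lp.fourierTransformₗᵢ (Space n) ℂ
  have hclosed : IsClosed {p : L2 n × L2 n | (F p.1, F p.2) ∈ (mulOp (symbol α)).graph} :=
    (isClosed_graph_mulOp (contDiff_symbol α).continuous.measurable).preimage
      ((F.continuous.comp continuous_fst).prodMk (F.continuous.comp continuous_snd))
  refine toLp_prod_mem_of_approx hclosed hm hm' fun ε hε => ?_
  obtain ⟨w, hw, hws, h1, h2⟩ := exists_smooth_approx_firstOrderOp
    (a := fun _ => EuclideanSpace.single α 1) (d := fun _ => 0) continuous_const continuous_const
    hv hs hε
  have hm : MemLp w 2 volume := hw.continuous.memLp_of_hasCompactSupport hws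
  have hm' := memLp_momentumOp α (hw.of_le (mod_cast le_top)) hws
  refine ⟨w, momentumOp α w, hm, hm', ?_, h1, h2⟩
  let s : SchwartzMap (Space n) ℂ := hws.toSchwartzMap hw
  have h3 : hm'.toLp (momentumOp α w)
      = (-I • LineDeriv.lineDerivOp (EuclideanSpace.single α (1 : ℝ)) s).toLp 2 volume := by
    refine MemLp.toLp_congr _ (SchwartzMap.memLp _ 2 volume)
      (Filter.Eventually.of_forall fun x => ?_)
    change -I * (fderiv ℝ w x (EuclideanSpace.single α 1) + ((0 / 2 : ℝ) : ℂ) * w x)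
      = -I * fderiv ℝ w x (EuclideanSpace.single α 1)
    simp
  have h4 := fourier_lineDeriv_mem_graph α s
  rw [← h3] at h4
  exact h4

/-- Smooth compactly supported functions form a core for multiplication by the symbol: the image
under `2π ξ_α - i` of a function `ψ / (2π ξ_α - i)` is the arbitrary test function `ψ`. -/
lemma exists_schwartz_approx_mulOp (α : Fin n) {h k : L2 n}
    (hk : (h, k) ∈ (mulOp (symbol α)).graph) {ε : ℝ} (hε : 0 < ε) :
    ∃ (φ : SchwartzMap (Space n) ℂ) (k' : L2 n), (φ.toLp 2 volume, k') ∈ (mulOp (symbol α)).graph ∧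
      dist h (φ.toLp 2 volume) < ε ∧ dist k k' < ε := by
  obtain ⟨u, ⟨ψ, hψ, hψs, hψd⟩, hu⟩ := Metric.mem_closure_iff.1
    (Lp.dense_hasCompactSupport_contDiff (F := ℂ) (p := 2) (μ := (volume : Measure (Space n)))
      (by norm_num) (k - I • h)) (ε / 2) (by positivity)
  have hne : ∀ ξ, (symbol α ξ : ℂ) - I ≠ 0 := fun ξ h => by
    simpa using congrArg Complex.im h
  have hsm : ContDiff ℝ ∞ fun ξ => ((symbol α ξ : ℂ) - I)⁻¹ * ψ ξ :=
    (((ofRealCLM.contDiff.comp (contDiff_symbol α)).sub contDiff_const).inv hne).mul hψd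
  have hcs : HasCompactSupport fun ξ => ((symbol α ξ : ℂ) - I)⁻¹ * ψ ξ := hψs.mul_left
  let φ : SchwartzMap (Space n) ℂ := hcs.toSchwartzMap hsm
  have hgr : (φ.toLp 2 volume, u + I • φ.toLp 2 volume) ∈ (mulOp (symbol α)).graph := by
    rw [mem_graph_mulOp]
    filter_upwards [hψ, SchwartzMap.coeFn_toLp φ 2 volume, Lp.coeFn_add u (I • φ.toLp 2 volume),
      Lp.coeFn_smul I (φ.toLp 2 volume)] with ξ h1 h2 h3 h4
    rw [h3, Pi.add_apply, h4, Pi.smul_apply, h1, h2, smul_eq_mul]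
    have h5 : φ ξ = ((symbol α ξ : ℂ) - I)⁻¹ * ψ ξ := rfl
    have := hne ξ
    rw [h5]
    field_simp
    ring
  obtain ⟨x, hx1, hx2⟩ := (mulOp (symbol α)).mem_graph_iff.1 (sub_mem hk hgr)
  simp only [Prod.fst_sub, Prod.snd_sub] at hx1 hx2
  have hres : mulOp (symbol α) x - I • (x : L2 n) = (k - I • h) - u := by
    rw [hx1, hx2, smul_sub]
    abel
  have hle := abs_im_mul_norm_le (isFormalAdjoint_mulOp (symbol α)) I x
  rw [hres, I_im, abs_one, one_mul] at hle
  have hu' : ‖(k - I • h) - u‖ < ε / 2 := by rwa [← dist_eq_norm]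
  refine ⟨φ, _, hgr, ?_, ?_⟩
  · rw [dist_eq_norm, ← hx1]
    linarith
  · rw [dist_eq_norm, ← hx2]
    have h6 : mulOp (symbol α) x = ((k - I • h) - u) + I • (x : L2 n) := by
      rw [← hres, sub_add_cancel]
    rw [h6]
    refine (norm_add_le _ _).trans_lt ?_
    rw [norm_smul, norm_I, one_mul]
    linarith

lemma mem_graph_opPDot (f : C3Diffeo n) (α : Fin n) (u : C03 n) :
    (C03.toL2 n u, symmMomentumL2 f α u) ∈ (opPDot f α).graph := by
  rw [LinearPMap.mem_graph_iff]
  refine ⟨⟨C03.toL2 n u, LinearMap.mem_range_self _ u⟩, rfl, ?_⟩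
  change symmMomentumL2 f α ((LinearEquiv.ofInjective (C03.toL2 n) C03.toL2_injective).symm
    ⟨C03.toL2 n u, _⟩) = _
  congr 1
  exact (LinearEquiv.ofInjective (C03.toL2 n) C03.toL2_injective).symm_apply_apply u

lemma exists_of_mem_graph_opPDot (f : C3Diffeo n) (α : Fin n) {p : L2 n × L2 n}
    (hp : p ∈ (opPDot f α).graph) : ∃ u : C03 n, p = (C03.toL2 n u, symmMomentumL2 f α u) := by
  obtain ⟨⟨x, u, rfl⟩, h1, h2⟩ := (opPDot f α).mem_graph_iff.1 hp
  obtain ⟨y, h3, h4⟩ := (opPDot f α).mem_graph_iff.1 (mem_graph_opPDot f α u)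
  have h5 : y = ⟨C03.toL2 n u, u, rfl⟩ := Subtype.ext h3
  exact ⟨u, Prod.ext h1.symm (by rw [← h2, ← h5]; exact h4)⟩

/-- The unitary operator which diagonalizes the momentum: passage to the coordinates `X = f(x)`
followed by the Fourier transform. -/
def diagonalizer (f : C3Diffeo n) : L2 n ≃ₗᵢ[ℂ] L2 n :=
  (pullbackUnitary f).symm.trans (Lp.fourierTransformₗᵢ (Space n) ℂ)

lemma diagonalizer_pullbackUnitary (f : C3Diffeo n) (v : L2 n) :
    diagonalizer f (pullbackUnitary f v) = Lp.fourierTransformₗᵢ (Space n) ℂ v := by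
  rw [diagonalizer, LinearIsometryEquiv.trans_apply, LinearIsometryEquiv.symm_apply_apply]

/-- The graph of multiplication by `2π ξ_α`, carried back to `L²` by the diagonalizer. -/
def diagonalGraph (f : C3Diffeo n) (α : Fin n) : Submodule ℂ (L2 n × L2 n) :=
  (mulOp (symbol α)).graph.comap
    ((diagonalizer f).toLinearEquiv.toLinearMap.prodMap (diagonalizer f).toLinearEquiv.toLinearMap)

lemma mem_diagonalGraph {f : C3Diffeo n} {α : Fin n} {p : L2 n × L2 n} :
    p ∈ diagonalGraph f α ↔
      (diagonalizer f p.1, diagonalizer f p.2) ∈ (mulOp (symbol α)).graph := Iff.rfl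

lemma isClosed_diagonalGraph (f : C3Diffeo n) (α : Fin n) :
    IsClosed (diagonalGraph f α : Set (L2 n × L2 n)) :=
  (isClosed_graph_mulOp (contDiff_symbol α).continuous.measurable).preimage
    (((diagonalizer f).continuous.comp continuous_fst).prodMk
      ((diagonalizer f).continuous.comp continuous_snd))

/-- In the coordinates `X = f(x)` the functions of `C₀³` become compactly supported and, because of
the weight, only `C²`; this is why the Fourier relation is needed for functions of class `C¹`. -/
lemma graph_opPDot_le_diagonalGraph (f : C3Diffeo n) (α : Fin n) :
    (opPDot f α).graph ≤ diagonalGraph f α := by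
  intro p hp
  obtain ⟨u, rfl⟩ := exists_of_mem_graph_opPDot f α hp
  have hu1 : ContDiff ℝ 1 (u : Space n → ℂ) := u.2.1.of_le (by norm_num)
  have hv := contDiff_pushforward f hu1
  have hvs := hasCompactSupport_pushforward f u.2.2
  have hm : MemLp (pushforward f u) 2 volume := hv.continuous.memLp_of_hasCompactSupport hvs
  have hm' := memLp_momentumOp α hv hvs
  have h1 : C03.toL2 n u = pullbackUnitary f (hm.toLp _) := by
    rw [pullbackUnitary_toLp]
    refine MemLp.toLp_congr (memLp_of_mem_C03 u) _ ?_
    rw [pullback_pushforward]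
  have h2 : symmMomentumL2 f α u = pullbackUnitary f (hm'.toLp _) := by
    rw [pullbackUnitary_toLp]
    refine MemLp.toLp_congr (memLp_symmMomentum f α u) _ ?_
    rw [symmMomentum_eq_firstOrderOp f α (hu1.differentiable (by norm_num)),
      ← firstOrderOp_pullback f α (hv.differentiable (by norm_num)), pullback_pushforward]
  rw [mem_diagonalGraph, h1, h2, diagonalizer_pullbackUnitary, diagonalizer_pullbackUnitary]
  exact fourier_momentumOp_mem_graph α hv hvs hm hm'

/-- The pullback of a `C¹` function need not be of class `C³`, so it lies in the domain of the
closure of the symmetrized momentum only, by mollification. -/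
lemma pullbackUnitary_momentumOp_mem_closure (f : C3Diffeo n) (α : Fin n) {v : Space n → ℂ}
    (hv : ContDiff ℝ 1 v) (hs : HasCompactSupport v) (hm : MemLp v 2 volume)
    (hm' : MemLp (momentumOp α v) 2 volume) :
    (pullbackUnitary f (hm.toLp v), pullbackUnitary f (hm'.toLp (momentumOp α v)))
      ∈ (opPDot f α).graph.topologicalClosure := by
  rw [pullbackUnitary_toLp, pullbackUnitary_toLp]
  refine toLp_prod_mem_of_approx (Submodule.isClosed_topologicalClosure _) _ _ fun ε hε => ?_
  obtain ⟨w, hw, hws, h1, h2⟩ := exists_smooth_approx_firstOrderOp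
    (contDiff_coordField f α).continuous (continuous_coordDiv f α) (contDiff_pullback f hv)
    (hasCompactSupport_pullback f hs) hε
  let w' : C03 n := ⟨w, contDiff_infty.1 hw 3, hws⟩
  have heq := symmMomentum_eq_firstOrderOp f α (u := w) (hw.differentiable (by norm_num))
  refine ⟨w, symmMomentum f α w, memLp_of_mem_C03 w', memLp_symmMomentum f α w',
    Submodule.le_topologicalClosure _ (mem_graph_opPDot f α w'), h1, ?_⟩
  rw [heq, ← firstOrderOp_pullback f α (hv.differentiable (by norm_num))]
  exact h2

open LineDeriv in
lemma pullbackUnitary_schwartz_mem_closure (f : C3Diffeo n) (α : Fin n)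
    (v : SchwartzMap (Space n) ℂ) :
    (pullbackUnitary f (v.toLp 2 volume),
      pullbackUnitary f ((-I • ∂_{EuclideanSpace.single α (1 : ℝ)} v).toLp 2 volume))
      ∈ (opPDot f α).graph.topologicalClosure := by
  let U := pullbackUnitary f
  have hclosed : IsClosed
      {p : L2 n × L2 n | (U p.1, U p.2) ∈ (opPDot f α).graph.topologicalClosure} :=
    (Submodule.isClosed_topologicalClosure _).preimage
      ((U.continuous.comp continuous_fst).prodMk (U.continuous.comp continuous_snd))
  refine toLp_prod_mem_of_approx hclosed (v.memLp 2 volume)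
    (SchwartzMap.memLp _ 2 volume) fun ε hε => ?_
  obtain ⟨w, hw, hws, h1, h2⟩ := exists_smooth_approx_schwartz v (EuclideanSpace.single α 1) hε
  have hw1 : ContDiff ℝ 1 w := hw.of_le (mod_cast le_top)
  have hm : MemLp w 2 volume := hw.continuous.memLp_of_hasCompactSupport hws
  have hm' := memLp_momentumOp α hw1 hws
  exact ⟨w, momentumOp α w, hm, hm',
    pullbackUnitary_momentumOp_mem_closure f α hw1 hws hm hm', h1, h2⟩

open LineDeriv FourierTransform in
/-- The inverse Fourier transforms of the core of Schwartz functions, pulled back by `f`, belong to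
the domain of the closure of the symmetrized momentum. -/
lemma diagonalGraph_le_closure (f : C3Diffeo n) (α : Fin n) :
    diagonalGraph f α ≤ (opPDot f α).graph.topologicalClosure := by
  rintro ⟨x, y⟩ hxy
  rw [← SetLike.mem_coe,
    ← (Submodule.isClosed_topologicalClosure (opPDot f α).graph).closure_eq, Metric.mem_closure_iff]
  intro ε hε
  obtain ⟨φ, k', hk', h1, h2⟩ := exists_schwartz_approx_mulOp α (mem_diagonalGraph.1 hxy) hε
  let v : SchwartzMap (Space n) ℂ := 𝓕⁻ φ
  have hF : Lp.fourierTransformₗᵢ (Space n) ℂ (v.toLp 2 volume) = φ.toLp 2 volume := by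
    change 𝓕 (v.toLp 2 volume) = φ.toLp 2 volume
    rw [SchwartzMap.toLp_fourier_eq, FourierTransform.fourier_fourierInv_eq]
  have hgr := fourier_lineDeriv_mem_graph α v
  rw [hF] at hgr
  have hk : Lp.fourierTransformₗᵢ (Space n) ℂ
      ((-I • ∂_{EuclideanSpace.single α (1 : ℝ)} v).toLp 2 volume) = k' :=
    (mulOp (symbol α)).mem_graph_snd_inj hgr hk' rfl
  refine ⟨_, pullbackUnitary_schwartz_mem_closure f α v, ?_⟩
  rw [Prod.dist_eq]
  refine max_lt ?_ ?_
  · rw [← (diagonalizer f).dist_map, diagonalizer_pullbackUnitary, hF]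
    exact h1
  · rw [← (diagonalizer f).dist_map, diagonalizer_pullbackUnitary, hk]
    exact h2

/-- The closure of the symmetrized momentum is unitarily equivalent to multiplication by
`2π ξ_α`. -/
lemma isDiagonalizedBy_closure_opPDot (f : C3Diffeo n) (α : Fin n) :
    IsDiagonalizedBy (opPDot f α).closure (diagonalizer f) (symbol α) := by
  have heq : (opPDot f α).graph.topologicalClosure = diagonalGraph f α :=
    le_antisymm (Submodule.topologicalClosure_minimal _ (graph_opPDot_le_diagonalGraph f α)
      (isClosed_diagonalGraph f α)) (diagonalGraph_le_closure f α)
  have hclosable : (opPDot f α).IsClosable := by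
    refine ⟨(diagonalGraph f α).toLinearPMap, ?_⟩
    rw [heq, Submodule.toLinearPMap_graph_eq]
    intro p hp h0
    have h1 := mem_diagonalGraph.1 hp
    rw [h0, map_zero] at h1
    exact (diagonalizer f).injective
      ((LinearPMap.graph_fst_eq_zero_snd _ h1 rfl).trans (map_zero _).symm)
  intro x y
  rw [← hclosable.graph_closure_eq_closure_graph, heq, mem_diagonalGraph]

lemma dense_domain_opPDot (f : C3Diffeo n) (α : Fin n) :
    Dense ((opPDot f α).domain : Set (L2 n)) := by
  refine (Lp.dense_hasCompactSupport_contDiff (F := ℂ) (p := 2)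
    (μ := (volume : Measure (Space n))) (by norm_num)).mono ?_
  rintro u ⟨g, hg, hgs, hgd⟩
  let w : C03 n := ⟨g, contDiff_infty.1 hgd 3, hgs⟩
  exact ⟨w, Lp.ext ((memLp_of_mem_C03 w).coeFn_toLp.trans hg.symm)⟩

lemma isEssentiallySelfAdjoint_opPDot (f : C3Diffeo n) (α : Fin n) :
    IsEssentiallySelfAdjoint (opPDot f α) := by
  have h := isDiagonalizedBy_closure_opPDot f α
  refine ⟨dense_domain_opPDot f α, fun x y => ?_,
    h.isSelfAdjoint (contDiff_symbol α).continuous.measurable⟩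
  have hle := (opPDot f α).le_closure
  rw [hle.2 (y := Submodule.inclusion hle.1 x) rfl, hle.2 (y := Submodule.inclusion hle.1 y) rfl]
  exact h.isFormalAdjoint (Submodule.inclusion hle.1 x) (Submodule.inclusion hle.1 y)

lemma volume_component_preimage (f : C3Diffeo n) (α : Fin n) (r : ℝ) :
    volume ((fun x => f x α) ⁻¹' {r}) = 0 :=
  f.quasiMeasurePreserving.preimage_null (volume_coordinate_eq α r)

lemma component_surjective (f : C3Diffeo n) (α : Fin n) :
    Function.Surjective fun x => f x α := by
  intro r
  exact ⟨f.symm (EuclideanSpace.single α r), by simp⟩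

lemma continuous_component (f : C3Diffeo n) (α : Fin n) : Continuous fun x => f x α :=
  (EuclideanSpace.proj (𝕜 := ℝ) α).continuous.comp f.continuous

end FourierDiagonalization

end PointTransformation

end

theorem theorem2p1 (n : ℕ) (f : PointTransformation.C3Diffeo n) (α : Fin n) :
    -- (a)
    IsSelfAdjoint (PointTransformation.opX f α) ∧
    -- (b)
    (PointTransformation.spectrum (PointTransformation.opX f α) = Set.range ((↑) : ℝ → ℂ) ∧
      PointTransformation.continuousSpectrum (PointTransformation.opX f α)
        = Set.range ((↑) : ℝ → ℂ)) ∧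
    -- (c)
    PointTransformation.IsEssentiallySelfAdjoint (PointTransformation.opPDot f α) ∧
    -- (d)
    (PointTransformation.spectrum (PointTransformation.opPDot f α).closure
        = Set.range ((↑) : ℝ → ℂ) ∧
      PointTransformation.continuousSpectrum (PointTransformation.opPDot f α).closure
        = Set.range ((↑) : ℝ → ℂ)) := by
  have hX := PointTransformation.isDiagonalizedBy_mulOp fun x => f x α
  have hg := PointTransformation.continuous_component f α
  exact ⟨hX.isSelfAdjoint hg.measurable,
    hX.spectrum_eq hg (PointTransformation.component_surjective f α)
      (PointTransformation.volume_component_preimage f α),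
    PointTransformation.isEssentiallySelfAdjoint_opPDot f α,
    (PointTransformation.isDiagonalizedBy_closure_opPDot f α).spectrum_eq
      (PointTransformation.contDiff_symbol α).continuous
      (PointTransformation.symbol_surjective α) (PointTransformation.volume_symbol_preimage α)⟩
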